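/- Let $G$ be a finite simple graph with vertex set $V(G)$ that is $d$-regular, where $d\ge\log_2|V(G)|\ge 8$. Then $$\chi'_{vd}(G)\le k(G)+3 .$$ Here, for an integer $k\ge 1$, an edge-$k$-coloring of $G$ is an assignment of colors from $\{1,\dots,k\}$ to the edges of $G$ such that no two adjacent edges receive the same color; it is vertex-distinguishing if, for any two distinct vertices $u,v$, the set of colors on the edges incident with $u$ differs from the set of colors on the edges incident with $v$. The vertex-distinguishing chromatic index $\chi'_{vd}(G)$ is the least integer $k$ for which $G$ has a vertex-distinguishing edge-$k$-coloring; in particular, such a $k$ exists under the above hypotheses. Finally, $k(G)$ is the least $k\in\mathbb N$ such that $\binom{k}{i}\ge n_i$ for every integer $i$ with $\delta(G)\le i\le\Delta(G)$, where $n_i$ is the number of vertices of degree $i$ in $G$ and $\delta(G)$, $\Delta(G)$ are the minimum and maximum degrees of $G$. -/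

import Mathlib

open Finset

namespace SimpleGraph

variable {V : Type*}

/-- An edge-`k`-coloring of `G`: a map from the edges of `G` to a set of `k` colors giving
distinct colors to any two adjacent edges (distinct edges with a common endpoint). -/
abbrev EdgeKColoring (G : SimpleGraph V) (k : ℕ) : Type _ :=
  G.lineGraph.Coloring (Fin k)

/-- The color-set of a vertex `v`: the colors of the edges incident with `v`. -/
def EdgeKColoring.colorSet {G : SimpleGraph V} {k : ℕ} (φ : G.EdgeKColoring k) (v : V) :
    Set (Fin k) :=
  {c | ∃ e : G.edgeSet, v ∈ (e : Sym2 V) ∧ φ e = c}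

/-- Distinct vertices have distinct color-sets. -/
def EdgeKColoring.IsVertexDistinguishing {G : SimpleGraph V} {k : ℕ} (φ : G.EdgeKColoring k) :
    Prop :=
  ∀ u v : V, u ≠ v → φ.colorSet u ≠ φ.colorSet v

/-- The vertex-distinguishing chromatic index: the least integer `k ≥ 1` such that `G` has a
vertex-distinguishing edge-`k`-coloring. It is `⊤` when there is no such `k`, so an inequality
with a finite right-hand side includes the existence of such a coloring. -/
noncomputable def vdChromaticIndex (G : SimpleGraph V) : ℕ∞ :=
  sInf {m : ℕ∞ | ∃ k : ℕ, m = k ∧ 1 ≤ k ∧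
    ∃ φ : G.EdgeKColoring k, φ.IsVertexDistinguishing}

/-- `n_d`, the number of vertices of degree `d`. -/
def numDegree [Fintype V] (G : SimpleGraph V) [DecidableRel G.Adj] (d : ℕ) : ℕ :=
  #{v : V | G.degree v = d}

/-- `k(G)`: the least natural number `k` such that `k.choose d ≥ n_d` for every `d` with
`δ(G) ≤ d ≤ Δ(G)`. (Such a `k` exists whenever `G` has at most one isolated vertex.) -/
noncomputable def vdLowerBound [Fintype V] (G : SimpleGraph V) [DecidableRel G.Adj] : ℕ :=
  sInf {k : ℕ | ∀ d ∈ Set.Icc G.minDegree G.maxDegree, G.numDegree d ≤ k.choose d}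

end SimpleGraph

/-! Let n be the number of vertices and k = k(G). Since n ≤ 2^d ≤ C(⌊3d/2⌋, d), regularity gives k ≤
3d/2. Split G into a sparse spanning subgraph H and the rest R, and color them from disjoint
palettes of 4 and k - 1 colors. Call the vertices with a given color set in R a class.

For R, Vizing's theorem yields a proper coloring; take one minimizing the sum of squares of the
class sizes. If there are at least as many m-sets of colors as vertices of degree m, then no class
of an m-set exceeds two vertices (`IsBalanced.classSize_le_two`): a class of size three would force
every m-set to be used (`IsBalanced.classSize_pos`). The tool is `IsProperOn.exists_transfer`, a
Kempe exchange along several chains at once that alters the class sizes only at its two ends.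

H then has to separate only the pairs left by R. It is colored edge by edge; `IsTidy.exists_load_le`
finds a last edge at which at most three of the four colors are excluded.

The counting condition dictates the shape of H. As C(k-1, d-1) = (d/k) C(k, d) ≥ 2n/3, at most two
thirds of the vertices may be leaves of H, while degrees 2 and 3 in H leave room for all n vertices.
Such an H comes from three classes of a Vizing coloring of G with d + 1 colors. -/

namespace SimpleGraph
variable {V : Type*} {α : Type*}

/-- A function on unordered pairs is a proper edge coloring of `G` if distinct edges of `G` at a
common vertex get distinct values; values off the edges of `G` are irrelevant. -/
def IsProperOn (G : SimpleGraph V) (c : Sym2 V → α) : Prop :=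
  ∀ ⦃v w w' : V⦄, G.Adj v w → G.Adj v w' → c s(v, w) = c s(v, w') → w = w'

open Classical in
/-- The finset of colors seen at the vertex `v`. -/
noncomputable def seen [Fintype α] (G : SimpleGraph V) (c : Sym2 V → α) (v : V) : Finset α :=
  univ.filter fun i => ∃ w, G.Adj v w ∧ c s(v, w) = i

/-! ### Proper edge colorings and color exchanges -/

section Basic

variable [Fintype α] {G : SimpleGraph V} {c : Sym2 V → α}

@[simp] lemma mem_seen {v : V} {i : α} : i ∈ G.seen c v ↔ ∃ w, G.Adj v w ∧ c s(v, w) = i := by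
  simp [seen]

open Classical in
lemma IsProperOn.card_seen [Fintype V] (hc : G.IsProperOn c) (v : V) :
    #(G.seen c v) = G.degree v := by
  rw [← card_neighborFinset_eq_degree]
  symm
  refine Finset.card_nbij (fun w => c s(v, w)) ?_ ?_ ?_
  · intro w hw
    simp only [coe_neighborFinset, mem_neighborSet, mem_coe, mem_seen] at hw ⊢
    exact ⟨w, hw, rfl⟩
  · intro w hw w' hw' h
    simp only [coe_neighborFinset, mem_neighborSet] at hw hw'
    exact hc hw hw' h
  · intro i hi
    simp only [mem_coe, mem_seen] at hi
    obtain ⟨w, hw, rfl⟩ := hi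
    exact ⟨w, by simpa using hw, rfl⟩

omit [Fintype α] in
lemma IsProperOn.mono {G' : SimpleGraph V} (h : G' ≤ G) (hc : G.IsProperOn c) :
    G'.IsProperOn c := fun _ _ _ h₁ h₂ => hc (h h₁) (h h₂)

variable [DecidableEq α]

/-- Exchanging the colors `a` and `b` on a set of vertices closed under the edges of these
colors. -/
lemma IsProperOn.exists_swap (hc : G.IsProperOn c) (a b : α) (X : Set V)
    (hX : ∀ v w, G.Adj v w → (c s(v, w) = a ∨ c s(v, w) = b) → v ∈ X → w ∈ X) :
    ∃ c' : Sym2 V → α, G.IsProperOn c' ∧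
      (∀ v ∈ X, G.seen c' v = (G.seen c v).map (Equiv.swap a b).toEmbedding) ∧
      ∀ v ∉ X, G.seen c' v = G.seen c v := by
  classical
  -- An edge leaving `X` has neither color, so the swap fixes its color and it does not matter that
  -- one end in `X` is enough to apply it.
  set c' : Sym2 V → α := fun e => if ∃ x ∈ X, x ∈ e then Equiv.swap a b (c e) else c e with hc'
  have hin : ∀ v ∈ X, ∀ w, c' s(v, w) = Equiv.swap a b (c s(v, w)) := by
    intro v hv w
    simp only [hc']
    rw [if_pos ⟨v, hv, by simp⟩]
  have hout : ∀ v ∉ X, ∀ w, G.Adj v w → c' s(v, w) = c s(v, w) := by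
    intro v hv w hvw
    by_cases hw : w ∈ X
    · have h : ¬(c s(w, v) = a ∨ c s(w, v) = b) := fun h => hv (hX w v hvw.symm h hw)
      rw [Sym2.eq_swap, not_or] at h
      rw [Sym2.eq_swap, hin w hw, Sym2.eq_swap, Equiv.swap_apply_of_ne_of_ne h.1 h.2]
    · simp only [hc']
      rw [if_neg]
      rintro ⟨x, hx, hxe⟩
      rcases Sym2.mem_iff.1 hxe with rfl | rfl <;> contradiction
  refine ⟨c', ?_, ?_, ?_⟩
  · intro v w w' hw hw' h
    by_cases hv : v ∈ X
    · rw [hin v hv, hin v hv] at h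
      exact hc hw hw' ((Equiv.swap a b).injective h)
    · rw [hout v hv w hw, hout v hv w' hw'] at h
      exact hc hw hw' h
  · intro v hv
    ext i
    simp only [mem_seen, mem_map_equiv, Equiv.symm_swap]
    refine exists_congr fun w => and_congr_right fun _ => ?_
    rw [hin v hv, Equiv.swap_apply_eq_iff]
  · intro v hv
    ext i
    simp only [mem_seen]
    exact exists_congr fun w => and_congr_right fun hw => by rw [hout v hv w hw]

end Basic

/-! ### Kempe chains and the pairing of their ends -/

section Ends

variable [Fintype V]

open Classical in
/-- In a graph of maximum degree at most two, the component of a vertex of degree one contains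
exactly one other vertex of degree one. -/
lemma exists_other_end (P : SimpleGraph V) (h2 : ∀ v, P.degree v ≤ 2) {u : V}
    (hu : P.degree u = 1) :
    ∃ z, z ≠ u ∧ P.Reachable u z ∧ P.degree z = 1 ∧
      ∀ w, P.Reachable u w → P.degree w = 1 → w = u ∨ w = z := by
  set C := P.connectedComponentMk u with hC
  have hmem : ∀ w, w ∈ C.supp ↔ P.Reachable u w := fun w => by
    rw [ConnectedComponent.mem_supp_iff, hC, ConnectedComponent.eq]
    exact ⟨Reachable.symm, Reachable.symm⟩
  set Q := P.induce C.supp with hQ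
  have hdeg : ∀ w : C.supp, Q.degree w = P.degree w := fun w => by
    refine degree_induce_of_neighborSet_subset fun x hx => ?_
    rw [hmem]
    exact ((hmem _).1 w.2).trans (Adj.reachable hx)
  have huC : u ∈ C.supp := (hmem u).2 (Reachable.refl u)
  have hconn : Q.Connected := C.connected_toSimpleGraph
  -- Connectedness makes the degree sum at least 2|C| - 2, whereas three vertices of degree one
  -- would make it at most 2|C| - 3. The second end exists by handshake parity.
  have hcard := hconn.card_vert_le_card_edgeSet_add_one
  have hsum := Q.sum_degrees_eq_twice_card_edges
  obtain ⟨z, hzu, hzodd⟩ := Q.exists_ne_odd_degree_of_exists_odd_degree ⟨u, huC⟩ (by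
    have := hdeg ⟨u, huC⟩
    simp only [hu] at this
    convert odd_one)
  have hz1 : Q.degree z = 1 := by
    have := h2 z
    rw [← hdeg] at this
    have h0 := hzodd
    interval_cases h : Q.degree z
    · simp at h0
    · rfl
    · exact absurd h0 (by decide)
  refine ⟨z, fun h => hzu (Subtype.ext h), (hmem _).1 z.2, by rw [← hdeg]; exact hz1, ?_⟩
  intro w hw hw1
  by_contra! hne
  have hwC : w ∈ C.supp := (hmem w).2 hw
  set u' : C.supp := ⟨u, huC⟩
  set w' : C.supp := ⟨w, hwC⟩
  have h3 : ∑ v : C.supp, Q.degree v + 3 ≤ 2 * Fintype.card C.supp := by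
    have hle : ∀ v : C.supp, Q.degree v + (if v ∈ ({u', z, w'} : Finset C.supp) then 1 else 0) ≤ 2 := by
      intro v
      split_ifs with hv
      · simp only [mem_insert, mem_singleton] at hv
        have : Q.degree v = 1 := by
          rcases hv with rfl | rfl | rfl
          · rw [hdeg]; exact hu
          · exact hz1
          · rw [hdeg]; exact hw1
        omega
      · rw [hdeg]; exact h2 v
    have hs := Finset.sum_le_sum (s := univ) fun v _ => hle v
    rw [Finset.sum_add_distrib, ← Finset.card_filter] at hs
    have hc3 : #({u', z, w'} : Finset C.supp) = 3 := by
      refine Finset.card_eq_three.2 ⟨u', z, w', fun h => hzu h.symm, ?_, ?_, rfl⟩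
      · intro h; exact hne.1 (congrArg Subtype.val h).symm
      · intro h; exact hne.2 (congrArg Subtype.val h).symm
    simp only [Finset.filter_univ_mem, hc3, Finset.sum_const, smul_eq_mul, Finset.card_univ] at hs
    omega
  rw [Nat.card_eq_fintype_card, Nat.card_eq_fintype_card, ← edgeFinset_card] at hcard
  omega

end Ends

/-- The subgraph formed by the edges of the colors `a` and `b`. -/
def twoColorGraph (G : SimpleGraph V) (c : Sym2 V → α) (a b : α) : SimpleGraph V where
  Adj v w := G.Adj v w ∧ (c s(v, w) = a ∨ c s(v, w) = b)
  symm.symm v w h := by rw [Sym2.eq_swap]; exact ⟨h.1.symm, h.2⟩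
  loopless.irrefl v h := G.loopless.irrefl v h.1

section Kempe

variable [Fintype V] [Fintype α] [DecidableEq α] {G : SimpleGraph V} {c : Sym2 V → α}

omit [Fintype V] [Fintype α] [DecidableEq α] in
lemma twoColorGraph_le (a b : α) : G.twoColorGraph c a b ≤ G := fun _ _ h => h.1

open Classical in
lemma IsProperOn.degree_twoColorGraph (hc : G.IsProperOn c) (a b : α) (v : V) :
    (G.twoColorGraph c a b).degree v = #((G.seen c v).filter fun i => i = a ∨ i = b) := by
  rw [← (hc.mono (twoColorGraph_le a b)).card_seen v]
  congr 1
  ext i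
  simp only [mem_seen, mem_filter, twoColorGraph]
  constructor
  · rintro ⟨w, ⟨h, h'⟩, rfl⟩
    exact ⟨⟨w, h, rfl⟩, h'⟩
  · rintro ⟨⟨w, h, rfl⟩, h'⟩
    exact ⟨w, ⟨h, h'⟩, rfl⟩

omit [Fintype V] [Fintype α] in
lemma card_filter_pair_le (S : Finset α) (a b : α) : #(S.filter fun i => i = a ∨ i = b) ≤ 2 :=
  (card_le_card (t := {a, b}) (by intro i; simp)).trans card_le_two

omit [Fintype V] [Fintype α] in
lemma card_filter_pair_eq_one {S : Finset α} {a b : α} (hab : a ≠ b) :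
    #(S.filter fun i => i = a ∨ i = b) = 1 ↔ ¬(a ∈ S ↔ b ∈ S) := by
  have h : (S.filter fun i => i = a ∨ i = b) = S.filter (· = a) ∪ S.filter (· = b) := by
    rw [filter_or]
  rw [h, card_union_of_disjoint]
  · rw [filter_eq', filter_eq']
    by_cases ha : a ∈ S <;> by_cases hb : b ∈ S <;> simp [ha, hb]
  · rw [disjoint_filter]
    rintro i - rfl
    exact hab

omit [Fintype V] [Fintype α] in
lemma map_swap_eq_self {S : Finset α} {a b : α} (h : a ∈ S ↔ b ∈ S) :
    S.map (Equiv.swap a b).toEmbedding = S := by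
  ext i
  rw [mem_map_equiv, Equiv.symm_swap, Equiv.swap_apply_def]
  split_ifs with h₁ h₂
  · rw [h₁, h]
  · rw [h₂, h]
  · rfl

/-- The vertices seeing exactly one of two colors come in pairs (the ends of Kempe chains), and
the two colors can be exchanged at any single pair. -/
lemma IsProperOn.exists_kempe_pairing (hc : G.IsProperOn c) {a b : α} (hab : a ≠ b) :
    ∃ π : V → V, ∀ u, ¬(a ∈ G.seen c u ↔ b ∈ G.seen c u) →
      π u ≠ u ∧ ¬(a ∈ G.seen c (π u) ↔ b ∈ G.seen c (π u)) ∧ π (π u) = u ∧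
      ∃ c' : Sym2 V → α, G.IsProperOn c' ∧
        (∀ w, w = u ∨ w = π u →
          G.seen c' w = (G.seen c w).map (Equiv.swap a b).toEmbedding) ∧
        ∀ w, w ≠ u → w ≠ π u → G.seen c' w = G.seen c w := by
  classical
  set P := G.twoColorGraph c a b with hP
  have h2 : ∀ v, P.degree v ≤ 2 := fun v => by
    rw [hP, hc.degree_twoColorGraph]; exact card_filter_pair_le _ _ _
  have h1 : ∀ v, P.degree v = 1 ↔ ¬(a ∈ G.seen c v ↔ b ∈ G.seen c v) := fun v => by
    rw [hP, hc.degree_twoColorGraph, card_filter_pair_eq_one hab]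
  have key : ∀ u, ∃ z, P.degree u = 1 → z ≠ u ∧ P.Reachable u z ∧ P.degree z = 1 ∧
      ∀ w, P.Reachable u w → P.degree w = 1 → w = u ∨ w = z := fun u => by
    by_cases hu : P.degree u = 1
    · obtain ⟨z, hz⟩ := exists_other_end P h2 hu
      exact ⟨z, fun _ => hz⟩
    · exact ⟨u, fun h => absurd h hu⟩
  choose π hπ using key
  refine ⟨π, fun u hu => ?_⟩
  rw [← h1] at hu
  obtain ⟨hne, hr, hd, hall⟩ := hπ u hu
  obtain ⟨hne', hr', hd', -⟩ := hπ (π u) hd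
  refine ⟨hne, (h1 _).1 hd, (hall _ (hr.trans hr') hd').resolve_right hne', ?_⟩
  obtain ⟨c', hc', hin, hout⟩ := hc.exists_swap a b {w | P.Reachable u w} (by
    intro v w hvw hcol hv
    exact Reachable.trans hv (Adj.reachable (G := P) ⟨hvw, hcol⟩))
  refine ⟨c', hc', ?_, ?_⟩
  · rintro w (rfl | rfl)
    · exact hin _ (Reachable.refl _)
    · exact hin _ hr
  · intro w hwu hwz
    by_cases hw : P.Reachable u w
    · rw [hin w hw, map_swap_eq_self]
      by_contra h
      rw [← h1] at h
      rcases hall w hw h with h | h <;> contradiction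
    · exact hout w hw

omit [Fintype V] [Fintype α] in
lemma even_card_of_pairing [DecidableEq V] {X : Finset V} (π : V → V) (hX : ∀ u ∈ X, π u ∈ X)
    (hne : ∀ u ∈ X, π u ≠ u) (hπ : ∀ u ∈ X, π (π u) = u) : Even #X := by
  have h : ∑ _u ∈ X, (1 : ZMod 2) = 0 :=
    Finset.sum_involution (fun u _ => π u) (fun _ _ => by decide) (fun u hu _ => hne u hu)
      (fun u hu => hX u hu) (fun u hu => hπ u hu)
  rw [sum_const, nsmul_one] at h
  exact (ZMod.natCast_eq_zero_iff_even).1 h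

end Kempe

/-! ### Vizing's theorem, one vertex at a time -/

section Vizing

variable [Fintype V] [Fintype α] [DecidableEq α] {G : SimpleGraph V}

/-- After recoloring with the colors in `C`, distinct missing colors from `C` can be chosen for the
vertices in `N`, if all of them, with at most one exception, miss two of these colors. -/
lemma exists_distinct_missing [DecidableEq V] (m : ℕ) :
    ∀ (N : Finset V) (C : Finset α) (c : Sym2 V → α) (L : V → Finset α) (w₀ : V),
      #N = m → #N ≤ #C → G.IsProperOn c → (∀ w ∈ N, L w ⊆ C) →
      (∀ w ∈ N, ∀ i ∈ L w, i ∉ G.seen c w) →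
      (∀ w ∈ N, w ≠ w₀ → #(L w) = 2) → (w₀ ∈ N → #(L w₀) = 1) →
      ∃ c' : Sym2 V → α, G.IsProperOn c' ∧
        (∀ v, ∀ i ∉ C, (i ∈ G.seen c' v ↔ i ∈ G.seen c v)) ∧
        ∃ g : V → α, Set.InjOn g N ∧ ∀ w ∈ N, g w ∈ C ∧ g w ∉ G.seen c' w := by
  induction m with
  | zero =>
    intro N C c L w₀ hN _ hc _ _ _ _
    rw [card_eq_zero] at hN
    subst hN
    by_cases hα : Nonempty α
    · exact ⟨c, hc, fun _ _ _ => Iff.rfl, fun _ => hα.some, by simp, by simp⟩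
    · rw [not_nonempty_iff] at hα
      exact ⟨c, hc, fun _ _ _ => Iff.rfl, fun v => c s(v, v), by simp, by simp⟩
  | succ m ih =>
    -- A color i listed at a single vertex w is assigned to w, and the induction continues without
    -- both. Recoloring there leaves the presence of colors outside the smaller palette unchanged,
    -- so i stays missing at w.
    have finish : ∀ (N : Finset V) (C : Finset α) (c : Sym2 V → α) (L : V → Finset α) (w₀ : V),
        #N = m + 1 → #N ≤ #C → G.IsProperOn c → (∀ w ∈ N, L w ⊆ C) →
        (∀ w ∈ N, ∀ i ∈ L w, i ∉ G.seen c w) →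
        (∀ w ∈ N, w ≠ w₀ → #(L w) = 2) → (w₀ ∈ N → #(L w₀) = 1) →
        (∃ i ∈ C, ∃ w ∈ N, i ∈ L w ∧ ∀ w' ∈ N, i ∈ L w' → w' = w) →
        ∃ c' : Sym2 V → α, G.IsProperOn c' ∧
          (∀ v, ∀ i ∉ C, (i ∈ G.seen c' v ↔ i ∈ G.seen c v)) ∧
          ∃ g : V → α, Set.InjOn g N ∧ ∀ w ∈ N, g w ∈ C ∧ g w ∉ G.seen c' w := by
      rintro N C c L w₀ hN hNC hc hLC hLs hL2 hL1 ⟨i, hiC, w, hwN, hiw, huniq⟩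
      obtain ⟨c', hc', hsame, g, hg, hgm⟩ := ih (N.erase w) (C.erase i) c L w₀
        (by rw [card_erase_of_mem hwN, hN]; rfl)
        (by rw [card_erase_of_mem hwN, card_erase_of_mem hiC]; omega) hc
        (by
          intro w' hw' j hj
          rw [mem_erase] at hw' ⊢
          refine ⟨?_, hLC w' hw'.2 hj⟩
          rintro rfl
          exact hw'.1 (huniq w' hw'.2 hj))
        (fun w' hw' => hLs w' (mem_of_mem_erase hw'))
        (fun w' hw' => hL2 w' (mem_of_mem_erase hw'))
        (fun hw' => hL1 (mem_of_mem_erase hw'))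
      refine ⟨c', hc', fun v j hj => hsame v j fun h => hj (mem_of_mem_erase h),
        Function.update g w i, ?_, ?_⟩
      · intro x hx y hy hxy
        rw [mem_coe] at hx hy
        by_cases hxw : x = w <;> by_cases hyw : y = w
        · rw [hxw, hyw]
        · rw [hxw, Function.update_self, Function.update_of_ne hyw] at hxy
          exact absurd hxy.symm (ne_of_mem_erase (hgm y (mem_erase.2 ⟨hyw, hy⟩)).1)
        · rw [hyw, Function.update_self, Function.update_of_ne hxw] at hxy
          exact absurd hxy (ne_of_mem_erase (hgm x (mem_erase.2 ⟨hxw, hx⟩)).1)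
        · rw [Function.update_of_ne hyw, Function.update_of_ne hxw] at hxy
          exact hg (by simp [hxw, hx]) (by simp [hyw, hy]) hxy
      · intro x hx
        by_cases hxw : x = w
        · rw [hxw, Function.update_self]
          exact ⟨hiC, fun h => hLs w hwN i hiw ((hsame w i (by simp)).1 h)⟩
        · rw [Function.update_of_ne hxw]
          have := hgm x (mem_erase.2 ⟨hxw, hx⟩)
          exact ⟨mem_of_mem_erase this.1, this.2⟩
    have main : ∀ (N : Finset V) (C : Finset α) (c : Sym2 V → α) (L : V → Finset α) (w₀ : V),
        #N = m + 1 → #N ≤ #C → G.IsProperOn c → (∀ w ∈ N, L w ⊆ C) →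
        (∀ w ∈ N, ∀ i ∈ L w, i ∉ G.seen c w) →
        (∀ w ∈ N, w ≠ w₀ → #(L w) = 2) → w₀ ∈ N → #(L w₀) = 1 →
        ∃ c' : Sym2 V → α, G.IsProperOn c' ∧
          (∀ v, ∀ i ∉ C, (i ∈ G.seen c' v ↔ i ∈ G.seen c v)) ∧
          ∃ g : V → α, Set.InjOn g N ∧ ∀ w ∈ N, g w ∈ C ∧ g w ∉ G.seen c' w := by
      intro N C c L w₀ hN hNC hc hLC hLs hL2 hw₀ hL1
      set X : α → Finset V := fun i => N.filter fun w => i ∈ L w with hX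
      by_cases hone : ∃ i ∈ C, #(X i) = 1
      · obtain ⟨i, hiC, hi⟩ := hone
        obtain ⟨w, hw⟩ := card_eq_one.1 hi
        have hmem : ∀ w', (w' ∈ N ∧ i ∈ L w') ↔ w' = w := fun w' => by
          rw [← mem_singleton, ← hw, hX, mem_filter]
        obtain ⟨hwN, hiw⟩ := (hmem w).2 rfl
        exact finish N C c L w₀ hN hNC hc hLC hLs hL2 (fun _ => hL1)
          ⟨i, hiC, w, hwN, hiw, fun w' h h' => (hmem w').1 ⟨h, h'⟩⟩
      · push Not at hone
        -- This total is odd and less than 2|C|. If no color is listed exactly once, some color i is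
        -- therefore listed nowhere and some j an odd number of times.
        have hsum : ∑ i ∈ C, #(X i) = 2 * m + 1 := by
          have h₁ : ∑ i ∈ C, #(X i) = ∑ w ∈ N, #(L w) := by
            simp only [hX, card_filter]
            rw [sum_comm]
            refine sum_congr rfl fun w hw => ?_
            rw [← card_filter, filter_mem_eq_inter, inter_eq_right.2 (hLC w hw)]
          rw [h₁, ← add_sum_erase N _ hw₀, hL1,
            sum_congr rfl fun w hw => hL2 w (mem_of_mem_erase hw) (ne_of_mem_erase hw), sum_const,
            card_erase_of_mem hw₀, hN]
          simp
          ring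
        obtain ⟨i, hiC, hi⟩ : ∃ i ∈ C, #(X i) = 0 := by
          by_contra! h
          have : ∑ i ∈ C, 2 ≤ ∑ i ∈ C, #(X i) := sum_le_sum fun i hi => by
            have := h i hi
            have := hone i hi
            omega
          rw [hsum, sum_const, smul_eq_mul] at this
          omega
        obtain ⟨j, hjC, hj⟩ : ∃ j ∈ C, Odd #(X j) := by
          by_contra! h
          have : Even (∑ i ∈ C, #(X i)) := Finset.even_sum _ fun i hi => by
            simpa using h i hi
          rw [hsum] at this
          exact absurd this (by simp)
        have hij : i ≠ j := by
          rintro rfl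
          rw [hi] at hj
          exact absurd hj (by decide)
        have hXi : ∀ w ∈ N, i ∉ L w := fun w hw h => by
          rw [card_eq_zero] at hi
          exact notMem_empty w (hi ▸ mem_filter.2 ⟨hw, h⟩)
        -- Once w misses i, replacing j by i in the list of w makes i a color listed exactly once.
        have step : ∀ (c' : Sym2 V → α) (w : V), w ∈ X j → G.IsProperOn c' →
            i ∉ G.seen c' w →
            (∀ v, ∀ l, l ≠ i → l ≠ j → (l ∈ G.seen c' v ↔ l ∈ G.seen c v)) →
            (∀ v ∈ N, v ≠ w → j ∈ L v → j ∉ G.seen c' v) →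
            ∃ c' : Sym2 V → α, G.IsProperOn c' ∧
              (∀ v, ∀ i ∉ C, (i ∈ G.seen c' v ↔ i ∈ G.seen c v)) ∧
              ∃ g : V → α, Set.InjOn g N ∧ ∀ w ∈ N, g w ∈ C ∧ g w ∉ G.seen c' w := by
          intro c' w hw hc' hiw hsame hjs
          obtain ⟨hwN, hjw⟩ := mem_filter.1 hw
          set L' := Function.update L w (insert i ((L w).erase j)) with hL'
          have hcard : ∀ v, #(L' v) = #(L v) := fun v => by
            by_cases hv : v = w
            · rw [hv, hL', Function.update_self, card_insert_of_notMem, card_erase_of_mem hjw]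
              · have : 0 < #(L w) := card_pos.2 ⟨j, hjw⟩
                omega
              · exact fun h => hXi w hwN (mem_of_mem_erase h)
            · rw [hL', Function.update_of_ne hv]
          obtain ⟨c'', hc'', hsame', hg⟩ := finish N C c' L' w₀ hN hNC hc'
            (by
              intro v hv
              by_cases hvw : v = w
              · rw [hvw, hL', Function.update_self]
                exact insert_subset hiC ((erase_subset _ _).trans (hLC w hwN))
              · rw [hL', Function.update_of_ne hvw]
                exact hLC v hv)
            (by
              intro v hv l hl
              by_cases hvw : v = w
              · rw [hvw, hL', Function.update_self, mem_insert, mem_erase] at hl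
                rw [hvw]
                rcases hl with rfl | ⟨hlj, hl⟩
                · exact hiw
                · rw [hsame w l (fun h => hXi w hwN (h ▸ hl)) hlj]
                  exact hLs w hwN l hl
              · rw [hL', Function.update_of_ne hvw] at hl
                by_cases hlj : l = j
                · rw [hlj] at hl ⊢
                  exact hjs v hv hvw hl
                · rw [hsame v l (fun h => hXi v hv (h ▸ hl)) hlj]
                  exact hLs v hv l hl)
            (fun v hv hv0 => by rw [hcard]; exact hL2 v hv hv0)
            (fun _ => by rw [hcard]; exact hL1)
            ⟨i, hiC, w, hwN, by rw [hL', Function.update_self]; exact mem_insert_self _ _, by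
              intro v hv hiv
              by_contra hvw
              rw [hL', Function.update_of_ne hvw] at hiv
              exact hXi v hv hiv⟩
          refine ⟨c'', hc'', fun v l hl => ?_, hg⟩
          rw [hsame' v l hl, hsame v l (fun h => hl (h ▸ hiC)) (fun h => hl (h ▸ hjC))]
        by_cases hfree : ∃ w ∈ X j, i ∉ G.seen c w
        · obtain ⟨w, hw, hiw⟩ := hfree
          exact step c w hw hc hiw (fun _ _ _ _ => Iff.rfl) fun v hv _ hjv => hLs v hv j hjv
        · push Not at hfree
          obtain ⟨π, hπ⟩ := hc.exists_kempe_pairing hij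
          have hend : ∀ w ∈ X j, ¬(i ∈ G.seen c w ↔ j ∈ G.seen c w) := fun w hw h => by
            obtain ⟨hwN, hjw⟩ := mem_filter.1 hw
            exact hLs w hwN j hjw (h.1 (hfree w hw))
          -- All of `X j` sees i and misses j, so these are chain ends, odd in number, and some
          -- chain leads out of `X j`. Exchanging on it frees i at w and keeps j missing at the rest
          -- of `X j`.
          obtain ⟨w, hw, hπw⟩ : ∃ w ∈ X j, π w ∉ X j := by
            by_contra! h
            exact Nat.not_even_iff_odd.2 hj (even_card_of_pairing π h
              (fun u hu => (hπ u (hend u hu)).1) fun u hu => (hπ u (hend u hu)).2.2.1)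
          obtain ⟨-, -, -, c', hc', hin, hout⟩ := hπ w (hend w hw)
          obtain ⟨hwN, hjw⟩ := mem_filter.1 hw
          refine step c' w hw hc' ?_ ?_ ?_
          · rw [hin w (Or.inl rfl), mem_map_equiv, Equiv.symm_swap, Equiv.swap_apply_left]
            exact hLs w hwN j hjw
          · intro v l hli hlj
            by_cases hv : v = w ∨ v = π w
            · rw [hin v hv, mem_map_equiv, Equiv.symm_swap, Equiv.swap_apply_of_ne_of_ne hli hlj]
            · rw [not_or] at hv
              rw [hout v hv.1 hv.2]
          · intro v hv hvw hjv
            rw [hout v hvw]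
            · exact hLs v hv j hjv
            · rintro rfl
              exact hπw (mem_filter.2 ⟨hv, hjv⟩)
    intro N C c L w₀ hN hNC hc hLC hLs hL2 hL1
    by_cases hw₀ : w₀ ∈ N
    · exact main N C c L w₀ hN hNC hc hLC hLs hL2 hw₀ (hL1 hw₀)
    · obtain ⟨w₁, hw₁⟩ : N.Nonempty := card_pos.1 (by omega)
      -- Without an exceptional vertex, one list is shortened to make the total odd.
      have h2 := hL2 w₁ hw₁ (fun h => hw₀ (h ▸ hw₁))
      obtain ⟨x, hx⟩ : (L w₁).Nonempty := card_pos.1 (by omega)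
      have hsub : ∀ w, Function.update L w₁ {x} w ⊆ L w := fun w => by
        by_cases h : w = w₁
        · rw [h, Function.update_self]; exact singleton_subset_iff.2 hx
        · rw [Function.update_of_ne h]
      exact main N C c (Function.update L w₁ {x}) w₁ hN hNC hc
        (fun w hw => (hsub w).trans (hLC w hw)) (fun w hw i hi => hLs w hw i (hsub w hi))
        (fun w hw h => by
          rw [Function.update_of_ne h]
          exact hL2 w hw fun h => hw₀ (h ▸ hw)) hw₁ (by simp)

/-- The spanning subgraph of the edges with both ends in `A`. -/
def restrictTo (G : SimpleGraph V) (A : Finset V) : SimpleGraph V where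
  Adj v w := G.Adj v w ∧ v ∈ A ∧ w ∈ A
  symm.symm _ _ h := ⟨h.1.symm, h.2.2, h.2.1⟩
  loopless.irrefl v h := G.loopless.irrefl v h.1

open Classical in
/-- **Vizing's theorem**: more colors than the maximum degree suffice for a proper edge
coloring. -/
theorem exists_isProperOn_of_degree_lt_card (G : SimpleGraph V)
    (hG : ∀ v, G.degree v < Fintype.card α) : ∃ c : Sym2 V → α, G.IsProperOn c := by
  suffices h : ∀ A : Finset V, ∃ c : Sym2 V → α, (G.restrictTo A).IsProperOn c by
    obtain ⟨c, hc⟩ := h univ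
    exact ⟨c, hc.mono (show G ≤ G.restrictTo univ from fun v w h => ⟨h, mem_univ _, mem_univ _⟩)⟩
  intro A
  induction A using Finset.induction_on with
  | empty =>
    by_cases hV : Nonempty V
    · have : Nonempty α := Fintype.card_pos_iff.1 ((Nat.zero_le _).trans_lt (hG hV.some))
      exact ⟨fun _ => this.some, fun v w _ h => absurd h.2.1 (notMem_empty v)⟩
    · rw [not_nonempty_iff] at hV
      exact ⟨fun e => hV.elim e.out.1, fun v => hV.elim v⟩
  | insert v A hvA ih =>
    obtain ⟨c, hc⟩ := ih
    set N := (G.neighborFinset v).filter (· ∈ A) with hN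
    -- One color is missing because the degree is less than the number of colors, a second because
    -- the edge to v is still uncolored.
    have hmiss : ∀ w, ∃ L : Finset α, w ∈ N → (#L = 2 ∧ ∀ i ∈ L, i ∉ (G.restrictTo A).seen c w) := by
      intro w
      by_cases hw : w ∈ N
      · have hvw : G.Adj v w := by simpa using (mem_filter.1 hw).1
        have hlt : #((G.restrictTo A).seen c w) < G.degree w := by
          rw [hc.card_seen, ← card_neighborFinset_eq_degree, ← card_neighborFinset_eq_degree]
          refine card_lt_card ⟨fun x hx => ?_, fun h => ?_⟩
          · rw [mem_neighborFinset] at hx ⊢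
            exact hx.1
          · have := h ((mem_neighborFinset _ _ _).2 hvw.symm)
            rw [mem_neighborFinset] at this
            exact hvA this.2.2
        obtain ⟨L, hLs, hL⟩ := exists_subset_card_eq (s := ((G.restrictTo A).seen c w)ᶜ) (n := 2) (by
          rw [card_compl]
          have := hG w
          omega)
        exact ⟨L, fun _ => ⟨hL, fun i hi => mem_compl.1 (hLs hi)⟩⟩
      · exact ⟨∅, fun h => absurd h hw⟩
    choose L hL using hmiss
    have hvN : v ∉ N := fun h => hvA (mem_filter.1 h).2
    obtain ⟨c', hc', -, g, hg, hgm⟩ := exists_distinct_missing (G := G.restrictTo A) #N N univ c L v rfl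
      (by
        rw [card_univ]
        refine le_trans ?_ (hG v).le
        rw [← card_neighborFinset_eq_degree]
        exact card_filter_le _ _) hc (fun _ _ => subset_univ _)
      (fun w hw => (hL w hw).2) (fun w hw _ => (hL w hw).1) (fun h => absurd h hvN)
    set c'' : Sym2 V → α := fun e => if h : v ∈ e then g (Sym2.Mem.other h) else c' e with hc''
    have hv : ∀ w, c'' s(v, w) = g w := fun w => by
      have h : v ∈ s(v, w) := by simp
      simp only [hc'']
      rw [dif_pos h]
      congr 1
      exact Sym2.congr_right.1 (Sym2.other_spec h)
    have hv' : ∀ w, c'' s(w, v) = g w := fun w => by rw [Sym2.eq_swap, hv]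
    have hnv : ∀ x y, x ≠ v → y ≠ v → c'' s(x, y) = c' s(x, y) := fun x y hx hy => by
      simp only [hc'']
      rw [dif_neg]
      rw [Sym2.mem_iff]
      tauto
    have hNmem : ∀ w, (G.restrictTo (insert v A)).Adj v w → w ∈ N := fun w h => by
      refine mem_filter.2 ⟨by simpa using h.1, ?_⟩
      exact (mem_insert.1 h.2.2).resolve_left h.1.ne'
    have hA : ∀ x y, (G.restrictTo (insert v A)).Adj x y → x ≠ v → y ≠ v →
        (G.restrictTo A).Adj x y := fun x y h hx hy =>
      ⟨h.1, (mem_insert.1 h.2.1).resolve_left hx, (mem_insert.1 h.2.2).resolve_left hy⟩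
    refine ⟨c'', fun x y y' hy hy' h => ?_⟩
    by_cases hxv : x = v
    · subst hxv
      rw [hv, hv] at h
      exact hg (hNmem y hy) (hNmem y' hy') h
    · by_cases hyv : y = v <;> by_cases hyv' : y' = v
      · rw [hyv, hyv']
      · rw [hyv, hv', hnv x y' hxv hyv'] at h
        rw [hyv] at hy
        exact absurd (mem_seen.2 ⟨y', hA x y' hy' hxv hyv', h.symm⟩) (hgm x (hNmem x hy.symm)).2
      · rw [hyv', hv', hnv x y hxv hyv] at h
        rw [hyv'] at hy'
        exact absurd (mem_seen.2 ⟨y, hA x y hy hxv hyv, h⟩) (hgm x (hNmem x hy'.symm)).2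
      · rw [hnv x y hxv hyv, hnv x y' hxv hyv'] at h
        exact hc' (hA x y hy hxv hyv) (hA x y' hy' hxv hyv') h

end Vizing

/-! ### Transfers between color classes -/

/-- Joining vertices of equal rank matches two fibers; the unmatched vertices are those of the
larger fiber whose rank is at least the size of the smaller. -/
lemma exists_rank [Fintype V] {β : Type*} [DecidableEq β] (f : V → β) :
    ∃ rank : V → ℕ, (∀ v, rank v < #{w | f w = f v}) ∧
      (∀ v w, f v = f w → rank v = rank w → v = w) ∧
      ∀ b, ∀ i < #{w | f w = b}, ∃ v, f v = b ∧ rank v = i := by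
  have hmem : ∀ v, v ∈ univ.filter fun w => f w = f v := fun v => by simp
  refine ⟨fun v => (univ.filter fun w => f w = f v).equivFin ⟨v, hmem v⟩, fun v => Fin.is_lt _,
    fun v w h h' => ?_, fun b i hi => ?_⟩
  · have aux : ∀ b (hb : b = f w) (hv : v ∈ univ.filter fun x => f x = b),
        ((univ.filter fun x => f x = b).equivFin ⟨v, hv⟩ : ℕ) =
          (univ.filter fun x => f x = f w).equivFin ⟨w, hmem w⟩ → v = w := by
      rintro _ rfl hv h
      exact congrArg Subtype.val (Equiv.injective _ (Fin.ext h))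
    exact aux (f v) h (hmem v) h'
  · obtain ⟨⟨v, hv⟩, hx⟩ := (univ.filter fun w => f w = b).equivFin.surjective ⟨i, hi⟩
    have hvb : f v = b := by simpa using hv
    subst hvb
    exact ⟨v, rfl, congrArg Fin.val hx⟩

section Swap

variable [DecidableEq α]

lemma map_swap_involutive (a b : α) (S : Finset α) :
    (S.map (Equiv.swap a b).toEmbedding).map (Equiv.swap a b).toEmbedding = S := by
  ext i
  simp [mem_map_equiv]

lemma map_swap_eq_self_iff {a b : α} {S : Finset α} :
    S.map (Equiv.swap a b).toEmbedding = S ↔ (a ∈ S ↔ b ∈ S) := by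
  refine ⟨fun h => ?_, map_swap_eq_self⟩
  conv_rhs => rw [← h]
  rw [mem_map_equiv, Equiv.symm_swap, Equiv.swap_apply_right]

lemma map_swap_eq_insert_erase {a b : α} {S : Finset α} (ha : a ∈ S) (hb : b ∉ S) :
    S.map (Equiv.swap a b).toEmbedding = insert b (S.erase a) := by
  ext i
  rw [mem_map_equiv, Equiv.symm_swap, Equiv.swap_apply_def, mem_insert, mem_erase]
  split_ifs with h₁ h₂
  · subst h₁
    simp only [hb, false_iff]
    rintro (rfl | h)
    · exact hb ha
    · exact h.1 rfl
  · simp [h₂, ha]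
  · simp [h₁, h₂]

end Swap

section Balanced

variable [Fintype V] [Fintype α] [DecidableEq α] {G : SimpleGraph V} {c : Sym2 V → α}

/-- The number of vertices whose set of colors is `S`. -/
noncomputable def classSize (G : SimpleGraph V) (c : Sym2 V → α) (S : Finset α) : ℕ :=
  #{v | G.seen c v = S}

set_option maxHeartbeats 400000 in
open Classical in
/-- Exchanging `a` and `b` along a chain of Kempe chains linked by matched vertices: one unit is
moved from the larger of two classes exchanged by `swap a b` to the smaller one, for one or two
such pairs of classes. -/
lemma IsProperOn.exists_transfer (hc : G.IsProperOn c) {a b : α} (hab : a ≠ b) {p : Finset α}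
    (hp : G.classSize c (p.map (Equiv.swap a b).toEmbedding) < G.classSize c p) :
    ∃ (r : Finset α) (c' : Sym2 V → α), G.IsProperOn c' ∧
      G.classSize c (r.map (Equiv.swap a b).toEmbedding) < G.classSize c r ∧
      (r = p → G.classSize c (p.map (Equiv.swap a b).toEmbedding) + 2 ≤ G.classSize c p) ∧
      ∀ S, G.classSize c' S + ((if S = p then 1 else 0) + if S = r then 1 else 0) =
        G.classSize c S + ((if S = p.map (Equiv.swap a b).toEmbedding then 1 else 0) +
          if S = r.map (Equiv.swap a b).toEmbedding then 1 else 0) := by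
  obtain ⟨σ, hσ⟩ : ∃ σ : Finset α → Finset α,
      ∀ S, S.map (Equiv.swap a b).toEmbedding = σ S := ⟨_, fun _ => rfl⟩
  simp only [hσ] at hp ⊢
  have hσσ : ∀ S, σ (σ S) = S := fun S => by rw [← hσ, ← hσ, map_swap_involutive]
  have hσinj : ∀ S T, S = σ T ↔ σ S = T := fun S T =>
    ⟨fun h => by rw [h, hσσ], fun h => by rw [← h, hσσ]⟩
  obtain ⟨rank, hlt, hinj, hsurj⟩ := exists_rank (G.seen c)
  -- P adds to the Kempe chains a matching between each class and its swapped class. Its vertices of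
  -- degree one are the unmatched chain ends, in the surplus of larger classes.
  obtain ⟨P, hP⟩ : ∃ P : SimpleGraph V, ∀ v w, P.Adj v w ↔ (G.twoColorGraph c a b).Adj v w ∨
      (G.seen c w = σ (G.seen c v) ∧ G.seen c w ≠ G.seen c v ∧ rank v = rank w) :=
    ⟨{ Adj := fun v w => (G.twoColorGraph c a b).Adj v w ∨
          (G.seen c w = σ (G.seen c v) ∧ G.seen c w ≠ G.seen c v ∧ rank v = rank w)
       symm := ⟨fun v w h => h.imp (fun h => h.symm) fun h =>
          ⟨by rw [h.1, hσσ], h.2.1.symm, h.2.2.symm⟩⟩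
       loopless := ⟨fun v h => h.elim (fun h => (G.twoColorGraph c a b).loopless.irrefl v h)
          fun h => h.2.1 rfl⟩ }, fun _ _ => Iff.rfl⟩
  have hfix : ∀ v, σ (G.seen c v) = G.seen c v ↔ (a ∈ G.seen c v ↔ b ∈ G.seen c v) :=
    fun v => by rw [← hσ, map_swap_eq_self_iff]
  have hd1 : ∀ v, (G.twoColorGraph c a b).degree v = 1 ↔ σ (G.seen c v) ≠ G.seen c v := fun v => by
    rw [hc.degree_twoColorGraph, card_filter_pair_eq_one hab, Ne, hfix]
  have hd2 : ∀ v, (G.twoColorGraph c a b).degree v ≤ 2 := fun v => by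
    rw [hc.degree_twoColorGraph]; exact card_filter_pair_le _ _ _
  have hnomatch : ∀ v, (σ (G.seen c v) = G.seen c v ∨ G.classSize c (σ (G.seen c v)) ≤ rank v) →
      P.degree v = (G.twoColorGraph c a b).degree v := by
    intro v hv
    rw [← card_neighborFinset_eq_degree, ← card_neighborFinset_eq_degree]
    congr 1
    ext w
    rw [mem_neighborFinset, mem_neighborFinset, hP]
    refine ⟨fun h => h.resolve_right ?_, Or.inl⟩
    rintro ⟨h₁, h₂, h₃⟩
    rcases hv with hv | hv
    · exact h₂ (h₁.trans hv)
    · have := hlt w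
      rw [h₁, ← h₃] at this
      exact absurd this (not_lt.2 hv)
  have hmatch : ∀ v, σ (G.seen c v) ≠ G.seen c v → rank v < G.classSize c (σ (G.seen c v)) →
      P.degree v = 2 := by
    intro v hv hr
    obtain ⟨w, hw, hwr⟩ := hsurj _ _ hr
    have hN : P.neighborFinset v = insert w ((G.twoColorGraph c a b).neighborFinset v) := by
      ext x
      rw [mem_insert, mem_neighborFinset, mem_neighborFinset, hP]
      constructor
      · rintro (h | h)
        · exact Or.inr h
        · exact Or.inl (hinj _ _ (h.1.trans hw.symm) (h.2.2.symm.trans hwr.symm))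
      · rintro (rfl | h)
        · exact Or.inr ⟨hw, by rw [hw]; exact hv, hwr.symm⟩
        · exact Or.inl h
    rw [← card_neighborFinset_eq_degree, hN, card_insert_of_notMem, card_neighborFinset_eq_degree,
      (hd1 v).2 hv]
    -- A matching edge is never also a chain edge: its color would lie in the set of v and in the
    -- swapped set, so v would see both colors and its set would be fixed by the swap.
    rw [mem_neighborFinset]
    rintro ⟨hvw, hcol⟩
    have hv' : c s(v, w) ∈ G.seen c v := mem_seen.2 ⟨w, hvw, rfl⟩
    have hw' : c s(v, w) ∈ σ (G.seen c v) := by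
      rw [← hw, Sym2.eq_swap]
      exact mem_seen.2 ⟨v, hvw.symm, rfl⟩
    rw [← hσ, mem_map_equiv, Equiv.symm_swap] at hw'
    refine hv ((hfix v).2 ?_)
    rcases hcol with h | h
    · rw [h] at hv' hw'
      rw [Equiv.swap_apply_left] at hw'
      exact ⟨fun _ => hw', fun _ => hv'⟩
    · rw [h] at hv' hw'
      rw [Equiv.swap_apply_right] at hw'
      exact ⟨fun _ => hv', fun _ => hw'⟩
  have h2 : ∀ v, P.degree v ≤ 2 := fun v => by
    by_cases h : σ (G.seen c v) = G.seen c v ∨ G.classSize c (σ (G.seen c v)) ≤ rank v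
    · rw [hnomatch v h]; exact hd2 v
    · rw [not_or, not_le] at h
      exact (hmatch v h.1 h.2).le
  have h1 : ∀ v, P.degree v = 1 ↔
      σ (G.seen c v) ≠ G.seen c v ∧ G.classSize c (σ (G.seen c v)) ≤ rank v := fun v => by
    by_cases h : σ (G.seen c v) = G.seen c v ∨ G.classSize c (σ (G.seen c v)) ≤ rank v
    · rw [hnomatch v h, hd1]
      exact ⟨fun h' => ⟨h', h.resolve_left h'⟩, fun h' => h'.1⟩
    · rw [not_or, not_le] at h
      rw [hmatch v h.1 h.2]
      exact ⟨fun h' => by omega, fun h' => absurd h'.2 (not_le.2 h.2)⟩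
  obtain ⟨u, hup, hur⟩ := hsurj p _ hp
  have hpne : σ p ≠ p := fun h => by rw [h] at hp; exact lt_irrefl _ hp
  have hu1 : P.degree u = 1 := by
    rw [h1, hup]
    exact ⟨hpne, hur.ge⟩
  obtain ⟨z, hzu, hzr, hz1, hzall⟩ := exists_other_end P h2 hu1
  set X : Set V := {w | P.Reachable u w} with hX
  have hXadj : ∀ v w, P.Adj v w → (v ∈ X ↔ w ∈ X) := fun v w h =>
    ⟨fun hv => Reachable.trans hv h.reachable, fun hw => Reachable.trans hw h.symm.reachable⟩
  obtain ⟨c', hc', hin, hout⟩ := hc.exists_swap a b X fun v w hvw hcol hv =>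
    (hXadj v w ((hP _ _).2 (Or.inl ⟨hvw, hcol⟩))).1 hv
  have hz := (h1 z).1 hz1
  -- Matched vertices of the component trade classes, so their moves cancel; only the ends u and z
  -- change class sizes. If both lie in p, they are two distinct surplus vertices.
  refine ⟨G.seen c z, c', hc', hz.2.trans_lt (hlt z), ?_, ?_⟩
  · intro hzp
    have hzlt := hlt z
    rw [hzp] at hz hzlt
    have hrne : rank z ≠ rank u := fun h => hzu (hinj _ _ (hzp.trans hup.symm) h)
    change rank z < G.classSize c p at hzlt
    omega
  · intro S
    have hsplit' : G.classSize c' S =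
        #{v | G.seen c v = σ S ∧ v ∈ X} + #{v | G.seen c v = S ∧ v ∉ X} := by
      rw [classSize, ← card_union_of_disjoint]
      · congr 1
        ext v
        simp only [mem_filter, mem_univ, true_and, mem_union]
        by_cases hv : v ∈ X
        · simp only [hv, and_true, not_true, and_false, or_false]
          rw [hin v hv, hσ, eq_comm, hσinj, eq_comm]
        · simp only [hv, and_true, not_false_iff, and_false, false_or]
          rw [hout v hv]
      · rw [disjoint_filter]
        rintro v - ⟨-, h⟩ ⟨-, h'⟩
        exact h' h
    have hsplit : G.classSize c S =
        #{v | G.seen c v = S ∧ v ∈ X} + #{v | G.seen c v = S ∧ v ∉ X} := by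
      rw [classSize, ← card_union_of_disjoint]
      · congr 1
        ext v
        simp only [mem_filter, mem_univ, true_and, mem_union]
        tauto
      · rw [disjoint_filter]
        rintro v - ⟨-, h⟩ ⟨-, h'⟩
        exact h' h
    by_cases hS : σ S = S
    · have e : ∀ T, S = σ T ↔ S = T := fun T => by rw [hσinj, hS]
      rw [hsplit', hsplit, hS]
      simp only [e]
    · have hends : ∀ T, σ T ≠ T → #{v | G.seen c v = T ∧ v ∈ X} =
          #{v | (G.seen c v = T ∧ v ∈ X) ∧ rank v < G.classSize c (σ T)} +
            ((if T = p then 1 else 0) + if T = G.seen c z then 1 else 0) := by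
        intro T hT
        rw [← card_filter_add_card_filter_not (s := univ.filter fun v => G.seen c v = T ∧ v ∈ X)
          (fun v => rank v < G.classSize c (σ T)), filter_filter, filter_filter]
        congr 1
        have : (univ.filter fun v => (G.seen c v = T ∧ v ∈ X) ∧ ¬rank v < G.classSize c (σ T)) =
            ({u, z} : Finset V).filter fun v => T = G.seen c v := by
          ext v
          simp only [mem_filter, mem_univ, true_and, mem_insert, mem_singleton, not_lt]
          constructor
          · rintro ⟨⟨h, hv⟩, hr⟩
            refine ⟨hzall v hv ((h1 v).2 ?_), h.symm⟩
            rw [h]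
            exact ⟨hT, hr⟩
          · rintro ⟨rfl | rfl, h⟩
            · subst h
              exact ⟨⟨rfl, Reachable.refl _⟩, ((h1 _).1 hu1).2⟩
            · subst h
              exact ⟨⟨rfl, hzr⟩, hz.2⟩
        rw [this, card_filter, sum_pair hzu.symm, hup]
      have hbij : #{v | (G.seen c v = S ∧ v ∈ X) ∧ rank v < G.classSize c (σ S)} =
          #{v | (G.seen c v = σ S ∧ v ∈ X) ∧ rank v < G.classSize c (σ (σ S))} := by
        have hex : ∀ v, ∃ w, (σ (G.seen c v) ≠ G.seen c v ∧ rank v < G.classSize c (σ (G.seen c v))) →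
            G.seen c w = σ (G.seen c v) ∧ rank w = rank v := fun v => by
          by_cases h : rank v < G.classSize c (σ (G.seen c v))
          · obtain ⟨w, hw⟩ := hsurj _ _ h
            exact ⟨w, fun _ => hw⟩
          · exact ⟨v, fun h' => absurd h'.2 h⟩
        choose m hm using hex
        have hmaps : ∀ T, σ T ≠ T → ∀ v, ((G.seen c v = T ∧ v ∈ X) ∧ rank v < G.classSize c (σ T)) →
            ((G.seen c (m v) = σ T ∧ m v ∈ X) ∧ rank (m v) < G.classSize c (σ (σ T))) ∧
              m (m v) = v := by
          rintro T hT v ⟨⟨rfl, hv⟩, hr⟩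
          obtain ⟨hm₁, hm₂⟩ := hm v ⟨hT, hr⟩
          have hlt' : rank (m v) < G.classSize c (σ (σ (G.seen c v))) := by
            rw [hσσ, hm₂]; exact hlt v
          obtain ⟨hm₃, hm₄⟩ := hm (m v) (by
            rw [hm₁]
            exact ⟨by rw [hσσ]; exact hT.symm, hlt'⟩)
          refine ⟨⟨⟨hm₁, (hXadj v (m v) ((hP _ _).2 (Or.inr ⟨hm₁, by rw [hm₁]; exact hT, hm₂.symm⟩))).1 hv⟩, hlt'⟩,
            hinj _ _ ?_ (hm₄.trans hm₂)⟩
          rw [hm₃, hm₁, hσσ]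
        refine card_nbij' m m ?_ ?_ ?_ ?_
        · intro v hv
          simp only [coe_filter, mem_univ, true_and, Set.mem_ofPred_eq] at hv ⊢
          exact (hmaps S hS v hv).1
        · intro v hv
          simp only [coe_filter, mem_univ, true_and, Set.mem_ofPred_eq] at hv ⊢
          have := (hmaps (σ S) (by rw [hσσ]; exact Ne.symm hS) v hv).1
          rwa [hσσ] at this
        · intro v hv
          simp only [coe_filter, mem_univ, true_and, Set.mem_ofPred_eq] at hv
          exact (hmaps S hS v hv).2
        · intro v hv
          simp only [coe_filter, mem_univ, true_and, Set.mem_ofPred_eq] at hv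
          exact (hmaps (σ S) (by rw [hσσ]; exact Ne.symm hS) v hv).2
      have hA := hends S hS
      have hB := hends (σ S) (by rw [hσσ]; exact Ne.symm hS)
      rw [hsplit', hsplit, hB, hA, hbij]
      simp only [← hσinj S]
      simp only [hσinj S]
      ring

end Balanced

/-! ### Balanced colorings have classes of at most two vertices -/

section Balanced

variable [Fintype V] [Fintype α] [DecidableEq α] {G : SimpleGraph V} {c : Sym2 V → α}

/-- The proper edge colorings whose class sizes have the least sum of squares. -/
def IsBalanced (G : SimpleGraph V) (c : Sym2 V → α) : Prop :=
  G.IsProperOn c ∧ ∀ c' : Sym2 V → α, G.IsProperOn c' →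
    ∑ S, G.classSize c S ^ 2 ≤ ∑ S, G.classSize c' S ^ 2

lemma IsProperOn.exists_isBalanced (hc : G.IsProperOn c) :
    ∃ c' : Sym2 V → α, G.IsBalanced c' := by
  classical
  obtain ⟨c', hc', hmin⟩ := exists_min_image
    (univ.filter fun c : Sym2 V → α => G.IsProperOn c) (fun c => ∑ S, G.classSize c S ^ 2)
    ⟨c, by simpa using hc⟩
  refine ⟨c', by simpa using hc', fun c'' h => hmin c'' (by simpa using h)⟩

/-- A transfer between classes leaves a balanced coloring balanced and permutes class sizes. -/
lemma IsBalanced.exists_exchange (hc : G.IsBalanced c) {a b : α} (hab : a ≠ b) {p q : Finset α}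
    (hq : p.map (Equiv.swap a b).toEmbedding = q) (hp : G.classSize c q < G.classSize c p) :
    ∃ c' : Sym2 V → α, G.IsBalanced c' ∧ G.classSize c' p = G.classSize c q ∧
      G.classSize c' q = G.classSize c p ∧
      ((G.classSize c p = G.classSize c q + 2 ∧
          ∀ S, S ≠ p → S ≠ q → G.classSize c' S = G.classSize c S) ∨
        (G.classSize c p = G.classSize c q + 1 ∧
          ∃ r s : Finset α, r.map (Equiv.swap a b).toEmbedding = s ∧
            G.classSize c r = G.classSize c s + 1 ∧ G.classSize c' r = G.classSize c s ∧
            G.classSize c' s = G.classSize c r ∧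
            ∀ S, S ≠ p → S ≠ q → S ≠ r → S ≠ s → G.classSize c' S = G.classSize c S)) := by
  subst hq
  obtain ⟨r, c', hc', hr, hrp, hsize⟩ := hc.1.exists_transfer hab hp
  have hinv := map_swap_involutive a b
  generalize hσ : p.map (Equiv.swap a b).toEmbedding = q at *
  generalize hτ : r.map (Equiv.swap a b).toEmbedding = s at *
  have hqp : q ≠ p := by rintro h; rw [h] at hp; exact lt_irrefl _ hp
  have hsr : s ≠ r := by rintro h; rw [h] at hr; exact lt_irrefl _ hr
  have hrq : r ≠ q := by
    rintro rfl
    rw [← hσ, hinv] at hτ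
    rw [← hτ] at hr
    exact lt_asymm hr hp
  have hmin := hc.2 c' hc'
  -- Writing p, q, r, s for class sizes too, the change is 2(1 - (p - q)) + 2(1 - (r - s)) when r
  -- and p are different sets, so minimality forces both differences to be 1. When they coincide it
  -- is 4(2 - (p - q)), forcing difference 2.
  have hdiff : (∑ S, (G.classSize c' S : ℤ) ^ 2) - ∑ S, (G.classSize c S : ℤ) ^ 2 =
      (G.classSize c q + G.classSize c' q) + (G.classSize c s + G.classSize c' s) -
        (G.classSize c p + G.classSize c' p) - (G.classSize c r + G.classSize c' r) := by
    rw [← sum_sub_distrib]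
    have : ∀ S, (G.classSize c' S : ℤ) ^ 2 - (G.classSize c S : ℤ) ^ 2 =
        (if S = q then (G.classSize c S + G.classSize c' S : ℤ) else 0) +
        (if S = s then (G.classSize c S + G.classSize c' S : ℤ) else 0) -
        (if S = p then (G.classSize c S + G.classSize c' S : ℤ) else 0) -
        (if S = r then (G.classSize c S + G.classSize c' S : ℤ) else 0) := by
      intro S
      have h := congrArg (Nat.cast : ℕ → ℤ) (hsize S)
      push_cast at h
      have h' : (G.classSize c' S : ℤ) - G.classSize c S =
        (if S = q then 1 else 0) + (if S = s then 1 else 0) - (if S = p then 1 else 0) -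
          (if S = r then 1 else 0) := by linarith
      rw [sq_sub_sq, h', add_comm (G.classSize c' S : ℤ)]
      simp only [mul_sub, mul_add, mul_ite, mul_one, mul_zero]
    rw [sum_congr rfl fun S _ => this S, sum_sub_distrib, sum_sub_distrib, sum_add_distrib]
    simp only [sum_ite_eq', mem_univ, if_true]
  have hle : (0 : ℤ) ≤ (∑ S, (G.classSize c' S : ℤ) ^ 2) - ∑ S, (G.classSize c S : ℤ) ^ 2 := by
    rw [sub_nonneg]
    exact_mod_cast hmin
  have hbal : (∑ S, (G.classSize c' S : ℤ) ^ 2) - ∑ S, (G.classSize c S : ℤ) ^ 2 = 0 →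
      G.IsBalanced c' := fun h => by
    refine ⟨hc', fun c'' hc'' => le_trans (le_of_eq ?_) (hc.2 c'' hc'')⟩
    rw [sub_eq_zero] at h
    exact_mod_cast h
  by_cases hr' : r = p
  · subst hr'
    have hqs : q = s := hσ.symm.trans hτ
    subst hqs
    have h₁ := hsize r
    have h₂ := hsize q
    simp only [if_true, if_neg hqp, if_neg hqp.symm] at h₁ h₂
    have h₃ := hrp rfl
    rw [hdiff] at hle hbal
    refine ⟨c', hbal (by omega), by omega, by omega, Or.inl ⟨by omega, fun S hS hS' => ?_⟩⟩
    have h₄ := hsize S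
    simp only [if_neg hS, if_neg hS'] at h₄
    omega
  · have hsp : s ≠ p := by
      rintro rfl
      rw [← hτ, hinv] at hσ
      exact hrq hσ
    have hsq : s ≠ q := by
      rintro rfl
      rw [← hσ] at hτ
      exact hr' (Finset.map_injective _ hτ)
    have h₁ := hsize p
    have h₂ := hsize q
    have h₃ := hsize r
    have h₄ := hsize s
    simp only [if_true, if_neg hqp, if_neg hqp.symm, if_neg hsr, if_neg hsr.symm, if_neg hrq,
      if_neg hrq.symm, if_neg hr', if_neg (Ne.symm hr'), if_neg hsp, if_neg hsp.symm, if_neg hsq,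
      if_neg hsq.symm] at h₁ h₂ h₃ h₄
    rw [hdiff] at hle hbal
    refine ⟨c', hbal (by omega), by omega, by omega, Or.inr ⟨by omega, r, s, hτ, by omega, by omega,
      by omega, fun S h₅ h₆ h₇ h₈ => ?_⟩⟩
    have h₉ := hsize S
    simp only [if_neg h₅, if_neg h₆, if_neg h₇, if_neg h₈] at h₉
    omega

/-- In a balanced coloring no class has three vertices while another class of the same kind is
empty: a closest pair of such classes leads to a contradiction. -/
lemma IsBalanced.classSize_pos (hc : G.IsBalanced c) {S S' : Finset α} (hS : 3 ≤ G.classSize c S)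
    (hcard : #S = #S') : 0 < G.classSize c S' := by
  by_contra h0
  rw [not_lt, Nat.le_zero] at h0
  set Bad : (Sym2 V → α) → Finset α → Finset α → Prop := fun c S S' =>
    G.IsBalanced c ∧ #S = #S' ∧ 3 ≤ G.classSize c S ∧ G.classSize c S' = 0 with hBad
  have hex : ∃ r, ∃ c S S', Bad c S S' ∧ #(S \ S') = r := ⟨_, c, S, S', ⟨hc, hcard, hS, h0⟩, rfl⟩
  classical
  obtain ⟨r, ⟨c₀, S₀, S₀', hbad₀, hr₀⟩, hmin'⟩ : ∃ r, (∃ c S S', Bad c S S' ∧ #(S \ S') = r) ∧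
      ∀ m < r, ¬∃ c S S', Bad c S S' ∧ #(S \ S') = m :=
    ⟨Nat.find hex, Nat.find_spec hex, fun m hm => Nat.find_min hex hm⟩
  have hmin : ∀ c S S', Bad c S S' → r ≤ #(S \ S') := fun c S S' h => by
    by_contra hlt
    exact hmin' _ (not_le.1 hlt) ⟨c, S, S', h, rfl⟩
  clear hmin' hex h0 hS hcard hc
  -- Let q = S - a + b and t = S' - b + a. As q is closer to S', the pair (q, S') is never bad.
  -- Exchanging S with q makes q large, so the transfer must also fill S', necessarily from t. This
  -- forces sizes 3, 2, 1, 0 for S, q, t, S', and (q, t) is a bad pair at the same distance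
  -- afterwards.
  have step : ∀ c S S', Bad c S S' → #(S \ S') = r → ∀ a ∈ S, a ∉ S' → ∀ b ∈ S', b ∉ S →
      G.classSize c (insert b (S.erase a)) = 2 ∧ G.classSize c (insert a (S'.erase b)) = 1 ∧
      2 ≤ r ∧ ∃ c', Bad c' (insert b (S.erase a)) (insert a (S'.erase b)) ∧
        #(insert b (S.erase a) \ insert a (S'.erase b)) = r ∧
        ∀ X, X ≠ S → X ≠ insert b (S.erase a) → X ≠ S' → X ≠ insert a (S'.erase b) →
          G.classSize c' X = G.classSize c X := by
    rintro c S S' ⟨hc, hcard, hS, hS'⟩ hr a haS haS' b hbS' hbS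
    have hab : a ≠ b := fun h => hbS (h ▸ haS)
    have hq := map_swap_eq_insert_erase haS hbS
    have ht : S'.map (Equiv.swap a b).toEmbedding = insert a (S'.erase b) := by
      rw [Equiv.swap_comm]; exact map_swap_eq_insert_erase hbS' haS'
    have hqS' : insert b (S.erase a) \ S' = (S \ S').erase a := by
      ext x
      simp only [mem_sdiff, mem_insert, mem_erase]
      constructor
      · rintro ⟨rfl | h, h'⟩
        · exact absurd hbS' h'
        · exact ⟨h.1, h.2, h'⟩
      · rintro ⟨h, h', h''⟩
        exact ⟨Or.inr ⟨h, h'⟩, h''⟩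
    have hqt : insert b (S.erase a) \ insert a (S'.erase b) = insert b ((S \ S').erase a) := by
      ext x
      simp only [mem_sdiff, mem_insert, mem_erase, not_or, not_and]
      constructor
      · rintro ⟨rfl | h, h', h''⟩
        · exact Or.inl rfl
        · by_cases hx : x = b
          · exact Or.inl hx
          · exact Or.inr ⟨h', h.2, h'' hx⟩
      · rintro (rfl | ⟨h, h', h''⟩)
        · exact ⟨Or.inl rfl, hab.symm, fun h => absurd rfl h⟩
        · exact ⟨Or.inr ⟨h, h'⟩, h, fun _ => h''⟩
    have haSS' : a ∈ S \ S' := mem_sdiff.2 ⟨haS, haS'⟩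
    have hrpos : 0 < #(S \ S') := card_pos.2 ⟨a, haSS'⟩
    have hcq' : #(insert b (S.erase a) \ S') = r - 1 := by
      rw [hqS', card_erase_of_mem haSS', hr]
    have hcqt : #(insert b (S.erase a) \ insert a (S'.erase b)) = r := by
      rw [hqt, card_insert_of_notMem, card_erase_of_mem haSS', hr]
      · omega
      · intro h
        exact hbS (mem_sdiff.1 (mem_of_mem_erase h)).1
    rw [← hq, ← ht] at *
    generalize hqq : S.map (Equiv.swap a b).toEmbedding = q at *
    generalize htt : S'.map (Equiv.swap a b).toEmbedding = t at *
    have hcardq : #q = #S := by rw [← hqq, card_map]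
    have hcardt : #t = #S' := by rw [← htt, card_map]
    have hnear : ∀ c', ¬Bad c' q S' := fun c' h => by
      have := hmin c' q S' h
      omega
    have hlt : G.classSize c q < G.classSize c S := by
      by_contra hle
      exact hnear c ⟨hc, hcardq.trans hcard, by omega, hS'⟩
    obtain ⟨c', hc', hc'S, hc'q, hcase⟩ := hc.exists_exchange hab hqq hlt
    have hSS' : S' ≠ S := fun h => by rw [h] at hS'; omega
    rcases hcase with ⟨h2, hoth⟩ | ⟨h1, x, y, hxy, hx, hc'x, hc'y, hoth⟩
    · have hS'q : S' ≠ q := fun h => by rw [h] at hS'; omega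
      exact (hnear c' ⟨hc', hcardq.trans hcard, by omega, by rw [hoth S' hSS' hS'q, hS']⟩).elim
    · have hS'q : S' ≠ q := fun h => by rw [h] at hS'; omega
      have hS'x : S' ≠ x := fun h => by rw [h] at hS'; omega
      have hS'y : S' = y := by
        by_contra h
        exact hnear c' ⟨hc', hcardq.trans hcard, by omega, by rw [hoth S' hSS' hS'q hS'x h, hS']⟩
      have hxt : x = t := by
        rw [← htt, hS'y, ← hxy, map_swap_involutive]
      subst hxt
      rw [← hS'y] at hx hc'x hoth
      have hq3 : G.classSize c q < 3 := by
        by_contra hle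
        exact hnear c ⟨hc, hcardq.trans hcard, by omega, hS'⟩
      refine ⟨by omega, by omega, ?_, c', ⟨hc', by omega, by omega, by omega⟩, hcqt,
        fun X h₁ h₂ h₃ h₄ => hoth X h₁ h₂ h₄ h₃⟩
      by_contra hr2
      refine hS'q (eq_of_subset_of_card_le ?_ (by omega)).symm
      rw [← sdiff_eq_empty_iff_subset, ← card_eq_zero]
      omega
  -- Steps move S towards X by single exchanges. They leave the size of X unchanged until X is one
  -- exchange away, where `step` gives 2.
  have two : ∀ m, ∀ c S S' X, Bad c S S' → #(S \ S') = r → #(S \ X) = m + 1 → #X = #S →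
      S ∩ S' ⊆ X → X ⊆ S ∪ S' → X ≠ S' → G.classSize c X = 2 := by
    intro m
    induction m with
    | zero =>
      intro c S S' X hbad hr hm hX hi hu hXS'
      obtain ⟨a, ha⟩ := card_eq_one.1 hm
      obtain ⟨b, hb⟩ : ∃ b, X \ S = {b} := card_eq_one.1 (by
        rw [card_sdiff_comm hX]; exact hm)
      have ha' := mem_sdiff.1 (ha ▸ mem_singleton_self a)
      have hb' := mem_sdiff.1 (hb ▸ mem_singleton_self b)
      have hXeq : X = insert b (S.erase a) := by
        ext x
        have h₁ : x ∈ S \ X ↔ x = a := by rw [ha, mem_singleton]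
        have h₂ : x ∈ X \ S ↔ x = b := by rw [hb, mem_singleton]
        rw [mem_sdiff] at h₁ h₂
        rw [mem_insert, mem_erase]
        tauto
      rw [hXeq]
      exact (step c S S' hbad hr a ha'.1 (fun h => ha'.2 (hi (mem_inter.2 ⟨ha'.1, h⟩))) b
        ((mem_union.1 (hu hb'.1)).resolve_left hb'.2) hb'.2).1
    | succ m ih =>
      intro c S S' X hbad hr hm hX hi hu hXS'
      obtain ⟨a, ha⟩ : (S \ X).Nonempty := card_pos.1 (by omega)
      obtain ⟨b, hb⟩ : (X \ S).Nonempty := card_pos.1 (by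
        rw [card_sdiff_comm hX]; omega)
      have ha' := mem_sdiff.1 ha
      have hb' := mem_sdiff.1 hb
      have haS' : a ∉ S' := fun h => ha'.2 (hi (mem_inter.2 ⟨ha'.1, h⟩))
      have hbS' : b ∈ S' := (mem_union.1 (hu hb'.1)).resolve_left hb'.2
      have hab : a ≠ b := fun h => hb'.2 (h ▸ ha'.1)
      obtain ⟨-, -, -, c', hbad', hr', hoth⟩ := step c S S' hbad hr a ha'.1 haS' b hbS' hb'.2
      have hsd : insert b (S.erase a) \ X = (S \ X).erase a := by
        ext x
        have : x = b → x ∈ X := fun h => h ▸ hb'.1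
        simp only [mem_sdiff, mem_insert, mem_erase]
        tauto
      have hsdc : #(insert b (S.erase a) \ X) = m + 1 := by
        rw [hsd, card_erase_of_mem ha, hm]; rfl
      have hXt : X ≠ insert a (S'.erase b) := fun h => ha'.2 (h ▸ mem_insert_self _ _)
      rw [← hoth X (fun h => by rw [h] at hm; simp at hm) (fun h => by rw [← h] at hsdc; simp at hsdc)
        hXS' hXt]
      refine ih c' _ _ X hbad' hr' hsdc ?_ ?_ ?_ hXt
      · rw [hX, card_insert_of_notMem (fun h => hb'.2 (mem_of_mem_erase h)),
          card_erase_of_mem ha'.1]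
        have := card_pos.2 ⟨a, ha'.1⟩
        omega
      · intro x hx
        simp only [mem_inter, mem_insert, mem_erase] at hx
        obtain ⟨rfl | h₁, rfl | h₂⟩ := hx
        · exact absurd rfl hab
        · exact absurd rfl h₂.1
        · exact absurd rfl h₁.1
        · exact hi (mem_inter.2 ⟨h₁.2, h₂.2⟩)
      · intro x hx
        have := mem_union.1 (hu hx)
        simp only [mem_union, mem_insert, mem_erase]
        tauto
  obtain ⟨hc, hcard, h3, h0⟩ := id hbad₀
  have hne : S₀ ≠ S₀' := fun h => by rw [h] at h3; omega
  obtain ⟨a, ha⟩ : (S₀ \ S₀').Nonempty := by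
    rw [nonempty_iff_ne_empty, Ne, sdiff_eq_empty_iff_subset]
    exact fun h => hne (eq_of_subset_of_card_le h hcard.ge)
  obtain ⟨b, hb⟩ : (S₀' \ S₀).Nonempty := by
    rw [nonempty_iff_ne_empty, Ne, sdiff_eq_empty_iff_subset]
    exact fun h => hne (eq_of_subset_of_card_le h hcard.le).symm
  have ha' := mem_sdiff.1 ha
  have hb' := mem_sdiff.1 hb
  obtain ⟨-, h1, hr2, -⟩ := step c₀ S₀ S₀' hbad₀ hr₀ a ha'.1 ha'.2 b hb'.1 hb'.2
  have hsd : S₀ \ insert a (S₀'.erase b) = (S₀ \ S₀').erase a := by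
    ext x
    have : x = b → x ∉ S₀ := fun h => h ▸ hb'.2
    simp only [mem_sdiff, mem_insert, mem_erase]
    tauto
  -- The set t lies between S and S' at distance r - 1 ≥ 1 from S, so its class has two vertices;
  -- `step` gave it one.
  have := two (r - 2) c₀ S₀ S₀' (insert a (S₀'.erase b)) hbad₀ hr₀
    (by rw [hsd, card_erase_of_mem ha, hr₀]; omega)
    (by
      rw [card_insert_of_notMem (fun h => ha'.2 (mem_of_mem_erase h)), card_erase_of_mem hb'.1, hcard]
      have := card_pos.2 ⟨b, hb'.1⟩
      omega)
    (by
      intro x hx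
      rw [mem_inter] at hx
      refine mem_insert_of_mem (mem_erase.2 ⟨?_, hx.2⟩)
      rintro rfl
      exact hb'.2 hx.1)
    (by
      intro x hx
      rcases mem_insert.1 hx with rfl | h
      · exact mem_union_left _ ha'.1
      · exact mem_union_right _ (mem_of_mem_erase h))
    (fun h => ha'.2 (h ▸ mem_insert_self _ _))
  omega

open Classical in
/-- If there are at least as many sets of `m` colors as vertices of degree `m`, then every class of
a balanced coloring consists of at most two of these vertices. -/
lemma IsBalanced.classSize_le_two (hc : G.IsBalanced c) {S : Finset α}
    (hm : #{v | G.degree v = #S} ≤ (Fintype.card α).choose #S) : G.classSize c S ≤ 2 := by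
  by_contra! h
  have hsum : ∑ T ∈ univ.powersetCard #S, G.classSize c T ≤ #{v | G.degree v = #S} := by
    have := sum_card_fiberwise_eq_card_filter univ (univ.powersetCard #S) (G.seen c)
    simp only [classSize]
    rw [this]
    refine (card_le_card fun v => ?_)
    simp only [mem_filter, mem_univ, true_and, mem_powersetCard, subset_univ, hc.1.card_seen]
    exact id
  have hlt : ∑ T ∈ (univ : Finset α).powersetCard #S, 1 <
      ∑ T ∈ univ.powersetCard #S, G.classSize c T := by
    refine sum_lt_sum (fun T hT => hc.classSize_pos h (mem_powersetCard.1 hT).2.symm)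
      ⟨S, mem_powersetCard.2 ⟨subset_univ _, rfl⟩, by omega⟩
  rw [sum_const, card_powersetCard, smul_eq_mul, mul_one, card_univ] at hlt
  omega

end Balanced

/-! ### Coloring a tidy graph with four colors -/

section DeleteEdge

variable [Fintype V]

open Classical in
lemma exists_deleteEdge {F : SimpleGraph V} {x y : V} (h : F.Adj x y) :
    ∃ F' : SimpleGraph V, (∀ v w, F'.Adj v w ↔ F.Adj v w ∧ s(v, w) ≠ s(x, y)) ∧
      F'.degree x + 1 = F.degree x ∧ F'.degree y + 1 = F.degree y ∧
      ∀ v, v ≠ x → v ≠ y → F'.degree v = F.degree v := by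
  obtain ⟨F', hF'⟩ : ∃ F' : SimpleGraph V, ∀ v w, F'.Adj v w ↔ F.Adj v w ∧ s(v, w) ≠ s(x, y) :=
    ⟨F.deleteEdges {s(x, y)}, fun v w => by rw [deleteEdges_adj, Set.mem_singleton_iff]⟩
  have hend : ∀ v w, F.Adj v w → s(v, w) = s(x, y) → F'.degree v + 1 = F.degree v := by
    intro v w hvw he
    rw [← card_neighborFinset_eq_degree, ← card_neighborFinset_eq_degree,
      show F'.neighborFinset v = (F.neighborFinset v).erase w by
        ext z
        rw [mem_erase, mem_neighborFinset, mem_neighborFinset, hF', ← he, Ne, Sym2.congr_right,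
          and_comm]]
    exact card_erase_add_one ((mem_neighborFinset _ _ _).2 hvw)
  refine ⟨F', hF', hend x y h rfl, hend y x h.symm Sym2.eq_swap, fun v hx hy => ?_⟩
  rw [← card_neighborFinset_eq_degree, ← card_neighborFinset_eq_degree]
  congr 1
  ext w
  rw [mem_neighborFinset, mem_neighborFinset, hF', Ne, Sym2.eq_iff]
  tauto

end DeleteEdge

section Tidy

variable [Fintype V]

open Classical in
/-- A spanning subgraph of degrees one to three without isolated edges, in which a path of length
two ending in a leaf hangs at each vertex of degree three. -/
structure IsTidy (H : SimpleGraph V) : Prop where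
  degree_pos : ∀ v, 1 ≤ H.degree v
  degree_le : ∀ v, H.degree v ≤ 3
  not_isolated : ∀ v w, H.Adj v w → H.degree v = 1 → H.degree w ≠ 1
  exists_pendant : ∀ x, H.degree x = 3 →
    ∃ u v, H.Adj x u ∧ H.Adj u v ∧ H.degree u = 2 ∧ H.degree v = 1

open Classical in
/-- No components are cycles. -/
def NoCycleComponent (H : SimpleGraph V) : Prop :=
  ∀ W : Set V, W.Nonempty → ¬∀ v ∈ W, H.degree v = 2 ∧ ∀ w, H.Adj v w → w ∈ W

open Classical in
/-- An upper bound for the number of colors excluded at the end `v` of the last edge of `F`, when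
`F` is colored edge by edge and the finished vertices of `H` are to be distinguished. -/
noncomputable def load (F H : SimpleGraph V) (v : V) : ℕ :=
  F.degree v - 1 + if F.degree v = H.degree v then 1 else 0

open Classical in
lemma adj_of_degree_eq {F H : SimpleGraph V} (h : F ≤ H) {v w : V} (hv : F.degree v = H.degree v)
    (hw : H.Adj v w) : F.Adj v w := by
  have : F.neighborFinset v = H.neighborFinset v :=
    eq_of_subset_of_card_le (fun x hx => by rw [mem_neighborFinset] at hx ⊢; exact h hx)
      (by rw [card_neighborFinset_eq_degree, card_neighborFinset_eq_degree, hv])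
  rw [← mem_neighborFinset, this, mem_neighborFinset]
  exact hw

open Classical in
lemma degree_pos_of_adj {F : SimpleGraph V} {v w : V} (h : F.Adj v w) : 1 ≤ F.degree v := by
  rw [Nat.one_le_iff_ne_zero, ← Nat.pos_iff_ne_zero, degree_pos_iff_exists_adj]
  exact ⟨w, h⟩

open Classical in
lemma degree_mono {F H : SimpleGraph V} (h : F ≤ H) (v : V) : F.degree v ≤ H.degree v := by
  rw [← card_neighborFinset_eq_degree, ← card_neighborFinset_eq_degree]
  exact card_le_card fun x hx => by rw [mem_neighborFinset] at hx ⊢; exact h hx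

/-- Suppose every edge of F has load at least 4. The middle vertex of a pendant path then has no
edge in F, so a vertex of degree 3 in H is unfinished and has load at most 1. All ends of edges now
have load exactly 2, are finished and have degree 2 in H: they form cycle components. -/
lemma IsTidy.exists_load_le {F H : SimpleGraph V} (hH : H.IsTidy) (hH' : H.NoCycleComponent)
    (hF : F ≤ H) (hne : F ≠ ⊥) : ∃ x y, F.Adj x y ∧ load F H x + load F H y ≤ 3 := by
  classical
  by_contra! hbad
  have hload : ∀ v, load F H v = F.degree v - 1 + if F.degree v = H.degree v then 1 else 0 :=
    fun v => rfl
  have hle := degree_mono hF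
  have hload2 : ∀ v w, F.Adj v w → load F H v ≤ H.degree v := fun v w h => by
    have := hle v
    have := degree_pos_of_adj h
    rw [hload]
    split_ifs <;> omega
  have hpend : ∀ u v, H.Adj u v → H.degree u = 2 → H.degree v = 1 → ∀ w, ¬F.Adj w u := by
    intro u v huv hu hv w hwu
    have h₁ := hload2 _ _ hwu
    have h₂ := hbad _ _ hwu
    have h₃ := hH.degree_le w
    have h₄ := hle u
    by_cases h : F.degree u = H.degree u
    · have huv' := adj_of_degree_eq hF h huv
      have h₅ := hload2 _ _ huv'
      have h₆ := hload2 _ _ huv'.symm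
      have h₇ := hbad _ _ huv'
      omega
    · have h₅ := hload u
      rw [if_neg h] at h₅
      omega
  have hthree : ∀ x, H.degree x = 3 → load F H x ≤ 1 := by
    intro x hx
    obtain ⟨u, v, hxu, huv, hu, hv⟩ := hH.exists_pendant x hx
    have h : F.degree x ≠ H.degree x := fun h => hpend u v huv hu hv x (adj_of_degree_eq hF h hxu)
    have := hle x
    rw [hload, if_neg h]
    omega
  have hall : ∀ x y, F.Adj x y → load F H x ≤ 2 := fun x y h => by
    have h₁ := hload2 _ _ h
    have h₂ := hH.degree_le x
    by_cases h₃ : H.degree x = 3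
    · exact (hthree x h₃).trans (by norm_num)
    · omega
  have heq : ∀ x y, F.Adj x y → H.degree x = 2 ∧ F.degree x = H.degree x := fun x y h => by
    have h₁ := hbad _ _ h
    have h₂ := hall _ _ h
    have h₃ := hall _ _ h.symm
    have h₄ := hload2 _ _ h
    have h₅ := hH.degree_le x
    have h₆ : H.degree x ≠ 3 := fun h₆ => by
      have := hthree x h₆
      omega
    refine ⟨by omega, ?_⟩
    by_contra h₇
    have h₈ := hload x
    rw [if_neg h₇] at h₈
    have := hle x
    omega
  obtain ⟨x, y, hxy⟩ := ne_bot_iff_exists_adj.1 hne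
  refine hH' {v | ∃ w, F.Adj v w} ⟨x, y, hxy⟩ fun v ⟨w, hvw⟩ => ⟨(heq v w hvw).1, fun w' hw' => ?_⟩
  exact ⟨v, (adj_of_degree_eq hF (heq v w hvw).2 hw').symm⟩

open Classical in
/-- Four colors suffice to color a tidy graph without cycle components properly such that the two
vertices of each class of `κ` are distinguished. -/
lemma IsTidy.exists_distinguishing {β : Type*} {H : SimpleGraph V} (hH : H.IsTidy)
    (hH' : H.NoCycleComponent) (κ : V → β) (hκ : ∀ u v, κ u = κ v → H.degree u = H.degree v)
    (hκ2 : ∀ u v w, κ v = κ u → κ w = κ u → v ≠ u → w ≠ u → v = w) :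
    ∃ c : Sym2 V → Fin 4, H.IsProperOn c ∧ ∀ u v, u ≠ v → κ u = κ v → H.seen c u ≠ H.seen c v := by
  suffices h : ∀ F ≤ H, ∃ c : Sym2 V → Fin 4, F.IsProperOn c ∧ ∀ u v, u ≠ v → κ u = κ v →
      F.degree u = H.degree u → F.degree v = H.degree v → F.seen c u ≠ F.seen c v by
    obtain ⟨c, hc, h⟩ := h H le_rfl
    exact ⟨c, hc, fun u v h₁ h₂ => h u v h₁ h₂ rfl rfl⟩
  intro F
  induction F using WellFoundedLT.induction with
  | ind F ih =>
  intro hF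
  by_cases hne : F = ⊥
  · subst hne
    refine ⟨fun _ => 0, fun v w _ h => absurd h (by simp), fun u v _ _ hu => ?_⟩
    have := hH.degree_pos u
    rw [← hu, ← card_neighborFinset_eq_degree] at this
    obtain ⟨w, hw⟩ := card_pos.1 this
    rw [mem_neighborFinset] at hw
    exact absurd hw (by simp)
  obtain ⟨x, y, hxy, hload⟩ := hH.exists_load_le hH' hF hne
  obtain ⟨F', hadj, hdx, hdy, hdv⟩ := exists_deleteEdge hxy
  have hF'le : F' ≤ F := fun v w h => ((hadj v w).1 h).1
  have hlt : F' < F := lt_of_le_of_ne hF'le fun h => by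
    rw [← h] at hxy
    exact ((hadj x y).1 hxy).2 rfl
  obtain ⟨c', hc', hdist⟩ := ih F' hlt (hF'le.trans hF)
  -- These colors would give a finished u the color set of its partner; a class of `κ` has at most
  -- two vertices, so there is at most one such color.
  set B : V → Finset (Fin 4) := fun u => univ.filter fun i => i ∉ F'.seen c' u ∧
    F.degree u = H.degree u ∧ ∃ v, v ≠ u ∧ κ v = κ u ∧ insert i (F'.seen c' u) = F'.seen c' v with hB
  have hBcard : ∀ u, #(B u) ≤ if F.degree u = H.degree u then 1 else 0 := by
    intro u
    split_ifs with h
    · rw [card_le_one]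
      intro i hi j hj
      simp only [hB, mem_filter, mem_univ, true_and] at hi hj
      obtain ⟨hi₁, -, v, hv, hvκ, hvi⟩ := hi
      obtain ⟨hj₁, -, w, hw, hwκ, hwj⟩ := hj
      rw [hκ2 u v w hvκ hwκ hv hw, ← hwj] at hvi
      exact ((mem_insert.1 (hvi ▸ mem_insert_self i _)).resolve_right hi₁)
    · rw [Nat.le_zero, card_eq_zero, filter_eq_empty_iff]
      rintro i - ⟨-, h', -⟩
      exact h h'
  obtain ⟨i, hi⟩ : ∃ i, i ∉ (F'.seen c' x ∪ B x) ∪ (F'.seen c' y ∪ B y) := by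
    by_contra! hall
    have h₁ : #(univ : Finset (Fin 4)) ≤ #((F'.seen c' x ∪ B x) ∪ (F'.seen c' y ∪ B y)) :=
      card_le_card fun i _ => hall i
    have h₂ := card_union_le (F'.seen c' x ∪ B x) (F'.seen c' y ∪ B y)
    have h₃ := card_union_le (F'.seen c' x) (B x)
    have h₄ := card_union_le (F'.seen c' y) (B y)
    have h₅ := hBcard x
    have h₆ := hBcard y
    rw [hc'.card_seen] at h₃ h₄
    rw [card_univ, Fintype.card_fin] at h₁
    unfold load at hload
    omega
  simp only [mem_union, not_or] at hi
  obtain ⟨⟨hix, hiBx⟩, hiy, hiBy⟩ := hi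
  obtain ⟨c, hci, hcc⟩ : ∃ c : Sym2 V → Fin 4, c s(x, y) = i ∧ ∀ e, e ≠ s(x, y) → c e = c' e :=
    ⟨Function.update c' s(x, y) i, by simp, fun e he => Function.update_of_ne he _ _⟩
  have hend : ∀ u w, s(u, w) = s(x, y) → i ∉ F'.seen c' u ∧ F.seen c u = insert i (F'.seen c' u) := by
    intro u w h
    have hiu : i ∉ F'.seen c' u := by
      rcases Sym2.eq_iff.1 h with h | h
      · rw [h.1]; exact hix
      · rw [h.1]; exact hiy
    refine ⟨hiu, ?_⟩
    ext j
    rw [mem_insert, mem_seen, mem_seen]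
    constructor
    · rintro ⟨v, hv, rfl⟩
      by_cases hvw : s(u, v) = s(x, y)
      · left; rw [hvw, hci]
      · right; exact ⟨v, (hadj u v).2 ⟨hv, hvw⟩, (hcc _ hvw).symm⟩
    · rintro (rfl | ⟨v, hv, rfl⟩)
      · refine ⟨w, ?_, by rw [h, hci]⟩
        rw [← mem_edgeSet, h, mem_edgeSet]
        exact hxy
      · obtain ⟨h₁, h₂⟩ := (hadj u v).1 hv
        exact ⟨v, h₁, hcc _ h₂⟩
  have hother : ∀ u, u ≠ x → u ≠ y → F.seen c u = F'.seen c' u := by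
    intro u hux huy
    have hn : ∀ v, s(u, v) ≠ s(x, y) := fun v h => by
      rcases Sym2.eq_iff.1 h with h | h
      · exact hux h.1
      · exact huy h.1
    ext j
    rw [mem_seen, mem_seen]
    exact exists_congr fun v => by rw [hadj, hcc _ (hn v)]; simp [hn v]
  obtain ⟨-, hsx⟩ := hend x y rfl
  obtain ⟨-, hsy⟩ := hend y x Sym2.eq_swap
  have hpair : ∀ u v, (u = x ∨ u = y) → v ≠ x → v ≠ y → κ v = κ u → F.degree u = H.degree u →
      F.seen c u ≠ F.seen c v := by
    intro u v hu hvx hvy hκv hdu h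
    rw [hother v hvx hvy] at h
    rcases hu with rfl | rfl
    · rw [hsx] at h
      exact hiBx (by simpa [hB] using ⟨by simpa using hix, hdu, v, hvx, hκv, h⟩)
    · rw [hsy] at h
      exact hiBy (by simpa [hB] using ⟨by simpa using hiy, hdu, v, hvy, hκv, h⟩)
  -- If both ends are finished and in one class, their equal degrees in H sum to at most 3, so xy is
  -- an isolated edge.
  have hself : ∀ u v, κ u = κ v → (u = x ∧ v = y) → F.degree u = H.degree u →
      F.degree v = H.degree v → False := by
    rintro u v huv ⟨rfl, rfl⟩ hu hv
    have h := hκ u v huv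
    unfold load at hload
    rw [if_pos hu, if_pos hv] at hload
    have := hH.degree_pos u
    exact hH.not_isolated u v (hF hxy) (by omega) (by omega)
  refine ⟨c, ?_, ?_⟩
  · intro u v w hv hw h
    by_cases h₁ : s(u, v) = s(x, y) <;> by_cases h₂ : s(u, w) = s(x, y)
    · exact Sym2.congr_right.1 (h₁.trans h₂.symm)
    · rw [h₁, hci, hcc _ h₂] at h
      exact absurd (mem_seen.2 ⟨w, (hadj u w).2 ⟨hw, h₂⟩, h.symm⟩) (hend u v h₁).1
    · rw [h₂, hci, hcc _ h₁] at h
      exact absurd (mem_seen.2 ⟨v, (hadj u v).2 ⟨hv, h₁⟩, h⟩) (hend u w h₂).1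
    · rw [hcc _ h₁, hcc _ h₂] at h
      exact hc' ((hadj u v).2 ⟨hv, h₁⟩) ((hadj u w).2 ⟨hw, h₂⟩) h
  · intro u v huv hκuv hu hv
    by_cases h₁ : u = x ∨ u = y <;> by_cases h₂ : v = x ∨ v = y
    · exfalso
      rcases h₁ with h₁ | h₁ <;> rcases h₂ with h₂ | h₂
      · exact huv (h₁.trans h₂.symm)
      · exact hself u v hκuv ⟨h₁, h₂⟩ hu hv
      · exact hself v u hκuv.symm ⟨h₂, h₁⟩ hv hu
      · exact huv (h₁.trans h₂.symm)
    · rw [not_or] at h₂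
      exact hpair u v h₁ h₂.1 h₂.2 hκuv.symm hu
    · rw [not_or] at h₁
      exact (hpair v u h₂ h₁.1 h₁.2 hκuv hv).symm
    · rw [not_or] at h₁ h₂
      rw [hother u h₁.1 h₁.2, hother v h₂.1 h₂.2]
      exact hdist u v huv hκuv (by rw [hdv u h₁.1 h₁.2, hu]) (by rw [hdv v h₂.1 h₂.2, hv])

end Tidy

/-! ### Existence of tidy subgraphs and their number of leaves -/

section Existence

variable [Fintype V]

open Classical in
/-- The degrees in the subgraph of the edges with colors in `I`. -/
lemma IsProperOn.degree_eq_card_inter [Fintype α] [DecidableEq α] {G K : SimpleGraph V}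
    {c : Sym2 V → α} (hc : G.IsProperOn c) (I : Finset α)
    (hK : ∀ v w, K.Adj v w ↔ G.Adj v w ∧ c s(v, w) ∈ I) (v : V) :
    K.degree v = #(G.seen c v ∩ I) := by
  rw [← (hc.mono (show K ≤ G from fun v w h => ((hK v w).1 h).1)).card_seen v]
  congr 1
  ext i
  simp only [mem_seen, mem_inter, hK]
  constructor
  · rintro ⟨w, ⟨h, h'⟩, rfl⟩
    exact ⟨⟨w, h, rfl⟩, h'⟩
  · rintro ⟨⟨w, h, rfl⟩, h'⟩
    exact ⟨w, ⟨h, h'⟩, rfl⟩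

/-- In a minimal tidy subgraph there is no cycle component: deleting an edge of one turns it into a
path with at least two edges, and pendant paths elsewhere survive. -/
lemma IsTidy.exists_noCycleComponent {K : SimpleGraph V} (hK : K.IsTidy) :
    ∃ H ≤ K, H.IsTidy ∧ H.NoCycleComponent := by
  classical
  obtain ⟨H, ⟨hHK, hH⟩, hmin⟩ := (Set.toFinite {H : SimpleGraph V | H ≤ K ∧ H.IsTidy}).exists_minimal
    ⟨K, le_rfl, hK⟩
  refine ⟨H, hHK, hH, fun W ⟨x, hx⟩ hW => ?_⟩
  have hx2 := (hW x hx).1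
  obtain ⟨y, hxy⟩ : ∃ y, H.Adj x y := by
    rw [← degree_pos_iff_exists_adj]; omega
  have hy := (hW x hx).2 y hxy
  have hy2 := (hW y hy).1
  obtain ⟨F, hadj, hdx, hdy, hdv⟩ := exists_deleteEdge hxy
  have hFH : F ≤ H := fun v w h => ((hadj v w).1 h).1
  have hends : ∀ v w, F.Adj v w → (v = x ∨ v = y) → F.degree w ≠ 1 := by
    intro v w h hv hw
    have hvW : v ∈ W := by rcases hv with rfl | rfl <;> assumption
    have hw2 := (hW w ((hW v hvW).2 w (hFH h))).1
    by_cases hwx : w = x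
    · rcases hv with hv | hv
      · exact h.ne (hv.trans hwx.symm)
      · exact ((hadj v w).1 h).2 (by rw [hv, hwx, Sym2.eq_swap])
    by_cases hwy : w = y
    · rcases hv with hv | hv
      · exact ((hadj v w).1 h).2 (by rw [hv, hwy])
      · exact h.ne (hv.trans hwy.symm)
    rw [hdv w hwx hwy] at hw
    omega
  have hFt : F.IsTidy := by
    refine ⟨fun v => ?_, fun v => (degree_mono hFH v).trans (hH.degree_le v), fun v w h hv hw => ?_,
      fun z hz => ?_⟩
    · by_cases h₁ : v = x
      · rw [h₁]; omega
      by_cases h₂ : v = y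
      · rw [h₂]; omega
      rw [hdv v h₁ h₂]
      exact hH.degree_pos v
    · by_cases h₁ : v = x ∨ v = y
      · exact hends v w h h₁ hw
      by_cases h₂ : w = x ∨ w = y
      · exact hends w v h.symm h₂ hv
      rw [not_or] at h₁ h₂
      rw [hdv v h₁.1 h₁.2] at hv
      rw [hdv w h₂.1 h₂.2] at hw
      exact hH.not_isolated v w (hFH h) hv hw
    · have hzx : z ≠ x := by rintro rfl; omega
      have hzy : z ≠ y := by rintro rfl; omega
      rw [hdv z hzx hzy] at hz
      obtain ⟨u, v, hzu, huv, hu, hv⟩ := hH.exists_pendant z hz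
      have hvW : v ∉ W := fun h => by
        have := (hW v h).1
        omega
      have huW : u ∉ W := fun h => hvW ((hW u h).2 v huv)
      have hux : u ≠ x := fun h => huW (h ▸ hx)
      have huy : u ≠ y := fun h => huW (h ▸ hy)
      have hvx : v ≠ x := fun h => hvW (h ▸ hx)
      have hvy : v ≠ y := fun h => hvW (h ▸ hy)
      refine ⟨u, v, (hadj _ _).2 ⟨hzu, ?_⟩, (hadj _ _).2 ⟨huv, ?_⟩, by rw [hdv u hux huy, hu],
        by rw [hdv v hvx hvy, hv]⟩
      · rw [Ne, Sym2.eq_iff]; tauto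
      · rw [Ne, Sym2.eq_iff]; tauto
  exact ((hadj x y).1 (hmin ⟨hFH.trans hHK, hFt⟩ hFH hxy)).2 rfl

-- With d + 1 colors each vertex misses exactly one, so three color classes form T with degrees 2 or
-- 3, and two of them form B with degrees 1 or 2. Take K minimal between B and T without isolated
-- edges. At a vertex x of degree 3 some edge xu is outside B; by minimality its deletion isolates
-- an edge, which must contain u and provides the pendant path.
open Classical in
lemma IsRegularOfDegree.exists_isTidy {G : SimpleGraph V} {d : ℕ}
    (hG : ∀ v, G.degree v = d) (hd : 2 ≤ d) : ∃ K ≤ G, K.IsTidy := by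
  obtain ⟨c, hc⟩ := G.exists_isProperOn_of_degree_lt_card (α := Fin (d + 1)) fun v => by
    rw [hG, Fintype.card_fin]; exact Nat.lt_succ_self d
  have hmiss : ∀ I : Finset (Fin (d + 1)), ∀ v, #I ≤ #(G.seen c v ∩ I) + 1 := fun I v => by
    have h₁ := card_sdiff_add_card_inter I (G.seen c v)
    have h₂ : #(I \ G.seen c v) ≤ #(G.seen c v)ᶜ := card_le_card fun i hi => by
      rw [mem_compl]; exact (mem_sdiff.1 hi).2
    rw [card_compl, hc.card_seen, hG, Fintype.card_fin] at h₂
    rw [inter_comm] at h₁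
    omega
  obtain ⟨I₃, -, hI₃⟩ := exists_subset_card_eq (s := (univ : Finset (Fin (d + 1)))) (n := 3)
    (by rw [card_univ, Fintype.card_fin]; omega)
  obtain ⟨I₂, hI, hI₂⟩ := exists_subset_card_eq (s := I₃) (n := 2) (by omega)
  have hsub : ∀ I : Finset (Fin (d + 1)), ∃ K : SimpleGraph V,
      ∀ v w, K.Adj v w ↔ G.Adj v w ∧ c s(v, w) ∈ I := fun I =>
    ⟨{ Adj := fun v w => G.Adj v w ∧ c s(v, w) ∈ I
       symm := ⟨fun v w h => ⟨h.1.symm, by rw [Sym2.eq_swap]; exact h.2⟩⟩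
       loopless := ⟨fun v h => G.loopless.irrefl v h.1⟩ }, fun _ _ => Iff.rfl⟩
  obtain ⟨B, hB⟩ := hsub I₂
  obtain ⟨T, hT⟩ := hsub I₃
  have hBdeg := hc.degree_eq_card_inter I₂ hB
  have hTdeg := hc.degree_eq_card_inter I₃ hT
  have hBT : B ≤ T := fun v w h => (hT v w).2 ⟨((hB v w).1 h).1, hI ((hB v w).1 h).2⟩
  have hB2 : ∀ v, B.degree v ≤ 2 := fun v => by
    rw [hBdeg, ← hI₂]; exact card_le_card inter_subset_right
  have hB1 : ∀ v, 1 ≤ B.degree v := fun v => by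
    have := hmiss I₂ v
    rw [hBdeg]; omega
  have hT3 : ∀ v, T.degree v ≤ 3 := fun v => by
    rw [hTdeg, ← hI₃]; exact card_le_card inter_subset_right
  have hT2 : ∀ v, 2 ≤ T.degree v := fun v => by
    have := hmiss I₃ v
    rw [hTdeg]; omega
  obtain ⟨K, ⟨hBK, hKT, hKiso⟩, hmin⟩ := (Set.toFinite {K : SimpleGraph V | B ≤ K ∧ K ≤ T ∧
      ∀ v w, K.Adj v w → K.degree v = 1 → K.degree w ≠ 1}).exists_minimal
    ⟨T, hBT, le_rfl, fun v w _ hv => by have := hT2 v; omega⟩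
  refine ⟨K, hKT.trans fun v w h => ((hT v w).1 h).1, fun v => (hB1 v).trans (degree_mono hBK v),
    fun v => (degree_mono hKT v).trans (hT3 v), hKiso, fun x hx => ?_⟩
  obtain ⟨u, hxu, hxuB⟩ : ∃ u, K.Adj x u ∧ ¬B.Adj x u := by
    by_contra! h
    have : K.degree x ≤ B.degree x := by
      rw [← card_neighborFinset_eq_degree, ← card_neighborFinset_eq_degree]
      exact card_le_card fun w hw => by rw [mem_neighborFinset] at hw ⊢; exact h w hw
    have := hB2 x
    omega
  obtain ⟨F, hadj, hdx, hdu, hdv⟩ := exists_deleteEdge hxu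
  have hFK : F ≤ K := fun v w h => ((hadj v w).1 h).1
  have hBF : B ≤ F := fun v w h => (hadj v w).2 ⟨hBK h, fun he => hxuB (by
    rw [← mem_edgeSet, ← he, mem_edgeSet]; exact h)⟩
  obtain ⟨p, q, hpq, hp, hq⟩ : ∃ p q, F.Adj p q ∧ F.degree p = 1 ∧ F.degree q = 1 := by
    by_contra! h
    exact ((hadj x u).1 (hmin ⟨hBF, hFK.trans hKT, h⟩ hFK hxu)).2 rfl
  have hxne : ∀ v, F.degree v = 1 → v ≠ x := by
    rintro v hv rfl
    omega
  have key : ∀ q, F.Adj u q → F.degree u = 1 → F.degree q = 1 →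
      ∃ u v, K.Adj x u ∧ K.Adj u v ∧ K.degree u = 2 ∧ K.degree v = 1 := fun q h hu hq =>
    ⟨u, q, hxu, hFK h, by omega, by rw [← hdv q (hxne q hq) h.ne']; exact hq⟩
  by_cases hpu : p = u
  · subst hpu
    exact key q hpq hp hq
  by_cases hqu : q = u
  · subst hqu
    exact key p hpq.symm hq hp
  exact absurd (by rw [← hdv q (hxne q hq) hqu]; exact hq)
    (hKiso p q (hFK hpq) (by rw [← hdv p (hxne p hp) hpu]; exact hp))

open Classical in
/-- At most two thirds of the vertices of a tidy graph are leaves. -/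
lemma IsTidy.three_mul_card_leaves_le {H : SimpleGraph V} (hH : H.IsTidy) :
    3 * #{v | H.degree v = 1} ≤ 2 * Fintype.card V := by
  have hex : ∀ v, ∃ w, H.Adj v w := fun v => by
    rw [← degree_pos_iff_exists_adj]; exact hH.degree_pos v
  choose f hf using hex
  -- Each leaf is charged to its neighbor, a non-leaf. No non-leaf is charged more than twice,
  -- because a vertex of degree 3 has a neighbor of degree 2.
  have h := card_le_mul_card_image_of_maps_to (s := {v | H.degree v = 1})
    (t := {v | ¬H.degree v = 1}) (f := f) (fun v hv => by
      rw [mem_filter] at hv ⊢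
      exact ⟨mem_univ _, hH.not_isolated v _ (hf v) hv.2⟩) 2 (fun w hw => by
      have hsub : ∀ v ∈ ({v ∈ ({v | H.degree v = 1} : Finset V) | f v = w}),
          H.Adj w v ∧ H.degree v = 1 := fun v hv => by
        simp only [mem_filter, mem_univ, true_and] at hv
        exact ⟨hv.2 ▸ (hf v).symm, hv.1⟩
      by_cases h3 : H.degree w = 3
      · obtain ⟨u, -, hwu, -, hu, -⟩ := hH.exists_pendant w h3
        refine (card_le_card (t := (H.neighborFinset w).erase u) fun v hv => ?_).trans ?_
        · rw [mem_erase, mem_neighborFinset]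
          refine ⟨?_, (hsub v hv).1⟩
          rintro rfl
          have := (hsub _ hv).2
          omega
        · rw [card_erase_of_mem ((mem_neighborFinset _ _ _).2 hwu), card_neighborFinset_eq_degree, h3]
      · refine (card_le_card (t := H.neighborFinset w) fun v hv => ?_).trans ?_
        · rw [mem_neighborFinset]
          exact (hsub v hv).1
        · rw [card_neighborFinset_eq_degree]
          have := hH.degree_le w
          omega)
  have := card_filter_add_card_filter_not (s := (univ : Finset V)) (fun v => H.degree v = 1)
  rw [card_univ] at this
  omega

end Existence

/-! ### Binomial estimates -/

section Numerics

/-- Raising d by 2 raises ⌊3d/2⌋ by 3. Pascal's rule applied three times gives at least 3 C(m, e+1)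
+ C(m, e), hence a factor of 4, as e + 1 is beyond the middle of row m. -/
lemma two_pow_le_choose (d : ℕ) (hd : 8 ≤ d) : 2 ^ d ≤ (3 * d / 2).choose d := by
  induction d using Nat.strong_induction_on with
  | _ d ih =>
  rcases (by omega : d = 8 ∨ d = 9 ∨ 10 ≤ d) with rfl | rfl | h10
  · decide
  · decide
  obtain ⟨e, rfl⟩ : ∃ e, d = e + 3 := ⟨d - 3, by omega⟩
  have h := ih (e + 1) (by omega) (by omega)
  obtain ⟨m, hm⟩ : ∃ m, 3 * (e + 1) / 2 = m := ⟨_, rfl⟩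
  rw [show 3 * (e + 3) / 2 = m + 3 by omega]
  rw [hm] at h
  have hlow : m.choose (e + 1) ≤ m.choose e := by
    have h₁ := Nat.choose_succ_right_eq m e
    have h₂ : m.choose e * (m - e) ≤ m.choose e * (e + 1) := Nat.mul_le_mul_left _ (by omega)
    exact Nat.le_of_mul_le_mul_right (h₁.trans_le h₂) (Nat.succ_pos e)
  have hpascal : (m + 3).choose (e + 3) = m.choose (e + 3) + 3 * m.choose (e + 2) +
      3 * m.choose (e + 1) + m.choose e := by
    simp only [Nat.choose_succ_succ']
    ring
  rw [hpascal, show 2 ^ (e + 3) = 4 * 2 ^ (e + 1) by ring]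
  omega

/-- The room for the sets of colors that remain when one color and one to three edges at each
vertex are set aside. -/
lemma le_choose_pred {n d k : ℕ} (hd : 8 ≤ d) (hn : 256 ≤ n) (hnd : n ≤ 2 ^ d) (hk : n ≤ k.choose d)
    (hkd : k ≤ 3 * d / 2) :
    d + 1 ≤ k ∧ 2 * n ≤ 3 * (k - 1).choose (d - 1) ∧ n ≤ (k - 1).choose (d - 2) ∧
      n ≤ (k - 1).choose (d - 3) := by
  have hdk : d + 1 ≤ k := by
    by_contra h
    rcases (by omega : k < d ∨ k = d) with h | rfl
    · rw [Nat.choose_eq_zero_of_lt h] at hk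
      omega
    · rw [Nat.choose_self] at hk
      omega
  obtain ⟨e, rfl⟩ : ∃ e, d = e + 3 := ⟨d - 3, by omega⟩
  obtain ⟨m, rfl⟩ : ∃ m, k = m + 1 := ⟨k - 1, by omega⟩
  simp only [Nat.add_sub_cancel, show e + 3 - 1 = e + 2 by omega, show e + 3 - 2 = e + 1 by omega]
  have h₁ : (m + 1) * m.choose (e + 2) = (m + 1).choose (e + 3) * (e + 3) :=
    Nat.add_one_mul_choose_eq m (e + 2)
  have h₂ : m.choose (e + 2) * (e + 2) = m.choose (e + 1) * (m - (e + 1)) :=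
    Nat.choose_succ_right_eq m (e + 1)
  have h₃ : m.choose (e + 1) * (e + 1) = m.choose e * (m - e) := Nat.choose_succ_right_eq m e
  have hone : 2 * n ≤ 3 * m.choose (e + 2) := by
    refine Nat.le_of_mul_le_mul_left (c := m + 1) ?_ (Nat.succ_pos m)
    have h₄ : n * (2 * (m + 1)) ≤ (m + 1).choose (e + 3) * (3 * (e + 3)) :=
      Nat.mul_le_mul hk (by omega)
    nlinarith
  -- C(k-1, d-2) = C(k, d) · d(d-1) / (k(k-d+1)), and k ≤ 3d/2 makes the fraction at least 1 for d ≥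
  -- 9. It can fail for d = 8, where n ≥ 256 forces k = 12 and C(11, 6) ≥ 2^8 is used.
  have htwo : n ≤ m.choose (e + 1) := by
    rcases (by omega : e = 5 ∨ 6 ≤ e) with rfl | he
    · rcases (by omega : m = 8 ∨ m = 9 ∨ m = 10 ∨ m = 11) with rfl | rfl | rfl | rfl
      · exact absurd (hn.trans hk) (by decide)
      · exact absurd (hn.trans hk) (by decide)
      · exact absurd (hn.trans hk) (by decide)
      · exact hnd.trans (by decide)
    · obtain ⟨l, rfl⟩ : ∃ l, m = e + 1 + l := ⟨m - (e + 1), by omega⟩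
      rw [Nat.add_sub_cancel_left] at h₂
      have hprod : (e + 1 + l + 1) * l ≤ (e + 3) * (e + 2) := by
        rcases (by omega : e = 6 ∨ 7 ≤ e) with rfl | he
        · have : l ≤ 5 := by omega
          interval_cases l <;> norm_num
        · have hl : 2 * l ≤ e + 5 := by omega
          have hl' : 2 * (e + 1 + l + 1) ≤ 3 * (e + 3) := by omega
          have := Nat.mul_le_mul hl' hl
          nlinarith
      have hl0 : 0 < (e + 1 + l + 1) * l := Nat.mul_pos (by omega) (by omega)
      refine Nat.le_of_mul_le_mul_right (c := (e + 1 + l + 1) * l) ?_ hl0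
      calc n * ((e + 1 + l + 1) * l) ≤ (e + 1 + l + 1).choose (e + 3) * ((e + 3) * (e + 2)) :=
            Nat.mul_le_mul hk hprod
        _ = (e + 1 + l + 1) * ((e + 1 + l).choose (e + 2) * (e + 2)) := by
            rw [← mul_assoc, ← h₁, mul_assoc]
        _ = (e + 1 + l).choose (e + 1) * ((e + 1 + l + 1) * l) := by rw [h₂]; ring
  refine ⟨hdk, hone, htwo, htwo.trans ?_⟩
  refine Nat.le_of_mul_le_mul_right (c := e + 1) ?_ (Nat.succ_pos e)
  rw [h₃]
  exact Nat.mul_le_mul_left _ (by omega)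

end Numerics

/-! ### Combining the two colorings -/

section Assembly

variable [Fintype V]

open Classical in
lemma degree_add_degree_of_adj_iff {G H R : SimpleGraph V} (h : H ≤ G)
    (hR : ∀ v w, R.Adj v w ↔ G.Adj v w ∧ ¬H.Adj v w) (v : V) :
    R.degree v + H.degree v = G.degree v := by
  rw [← card_neighborFinset_eq_degree, ← card_neighborFinset_eq_degree,
    ← card_neighborFinset_eq_degree, ← card_union_of_disjoint]
  · congr 1
    ext w
    simp only [mem_union, mem_neighborFinset, hR]
    have := @h v w
    tauto
  · rw [Finset.disjoint_left]
    intro w hw hw'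
    rw [mem_neighborFinset] at hw hw'
    exact ((hR _ _).1 hw).2 hw'

omit [Fintype V] in
/-- Proper colorings of a subgraph and of its complement in `G` combine to an edge coloring of `G`
whose color sets determine those of both parts. -/
lemma exists_edgeKColoring_of_isProperOn {p q k : ℕ} (hk : p + q = k) {G H R : SimpleGraph V}
    (hR : ∀ v w, R.Adj v w ↔ G.Adj v w ∧ ¬H.Adj v w) {c₁ : Sym2 V → Fin p} {c₂ : Sym2 V → Fin q} (h₁ : R.IsProperOn c₁)
    (h₂ : H.IsProperOn c₂) (hH : H ≤ G) :
    ∃ φ : G.EdgeKColoring k, ∀ u v, φ.colorSet u = φ.colorSet v →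
      R.seen c₁ u = R.seen c₁ v ∧ H.seen c₂ u = H.seen c₂ v := by
  classical
  obtain ⟨ι⟩ : Nonempty (Fin p ⊕ Fin q ≃ Fin k) := ⟨Fintype.equivFinOfCardEq (by simp [hk])⟩
  obtain ⟨f, hfH, hfR⟩ : ∃ f : Sym2 V → Fin p ⊕ Fin q,
      (∀ v w, H.Adj v w → f s(v, w) = Sum.inr (c₂ s(v, w))) ∧
      ∀ v w, ¬H.Adj v w → f s(v, w) = Sum.inl (c₁ s(v, w)) :=
    ⟨fun e => if e ∈ H.edgeSet then Sum.inr (c₂ e) else Sum.inl (c₁ e),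
      fun v w h => if_pos h, fun v w h => if_neg h⟩
  have hf : G.IsProperOn f := by
    intro v w w' hw hw' h
    by_cases hH₁ : H.Adj v w <;> by_cases hH₂ : H.Adj v w'
    · rw [hfH _ _ hH₁, hfH _ _ hH₂] at h
      exact h₂ hH₁ hH₂ (Sum.inr_injective h)
    · rw [hfH _ _ hH₁, hfR _ _ hH₂] at h
      cases h
    · rw [hfR _ _ hH₁, hfH _ _ hH₂] at h
      cases h
    · rw [hfR _ _ hH₁, hfR _ _ hH₂] at h
      exact h₁ ((hR _ _).2 ⟨hw, hH₁⟩) ((hR _ _).2 ⟨hw', hH₂⟩) (Sum.inl_injective h)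
  let φ : G.EdgeKColoring k := Coloring.mk (fun e => ι (f e)) (by
    rintro ⟨e, he⟩ ⟨e', he'⟩ hadj h
    obtain ⟨hne, v, hv, hv'⟩ := lineGraph_adj_iff_exists.1 hadj
    obtain ⟨w, rfl⟩ := Sym2.mem_iff_exists.1 hv
    obtain ⟨w', rfl⟩ := Sym2.mem_iff_exists.1 hv'
    have := hf he he' (ι.injective h)
    subst this
    exact hne rfl)
  have hφ : ∀ v x, ι x ∈ φ.colorSet v ↔ ∃ w, G.Adj v w ∧ f s(v, w) = x := by
    intro v x
    constructor
    · rintro ⟨⟨e, he⟩, hv, h⟩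
      obtain ⟨w, rfl⟩ := Sym2.mem_iff_exists.1 hv
      exact ⟨w, he, ι.injective h⟩
    · rintro ⟨w, hw, rfl⟩
      exact ⟨⟨s(v, w), hw⟩, by simp, rfl⟩
  have hφ₁ : ∀ v i, ι (Sum.inl i) ∈ φ.colorSet v ↔ i ∈ R.seen c₁ v := fun v i => by
    rw [hφ, mem_seen]
    refine exists_congr fun w => ?_
    rw [hR]
    by_cases hw : H.Adj v w
    · simp [hw, hfH]
    · simp [hw, hfR]
  have hφ₂ : ∀ v i, ι (Sum.inr i) ∈ φ.colorSet v ↔ i ∈ H.seen c₂ v := fun v i => by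
    rw [hφ, mem_seen]
    refine exists_congr fun w => ?_
    by_cases hw : H.Adj v w
    · simp [hw, hfH, hH hw]
    · simp [hw, hfR]
  refine ⟨φ, fun u v h => ⟨?_, ?_⟩⟩
  · ext i
    rw [← hφ₁, ← hφ₁, h]
  · ext i
    rw [← hφ₂, ← hφ₂, h]

open Classical in
/-- The main construction: a tidy subgraph receives four colors, the rest of the graph a balanced
coloring with `k - 1` colors. -/
theorem exists_isVertexDistinguishing {G : SimpleGraph V} {d k : ℕ} (hG : ∀ v, G.degree v = d)
    (hd : 8 ≤ d) (hn : 256 ≤ Fintype.card V) (hnd : Fintype.card V ≤ 2 ^ d)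
    (hk : Fintype.card V ≤ k.choose d) (hkd : k ≤ 3 * d / 2) :
    ∃ φ : G.EdgeKColoring (k + 3), φ.IsVertexDistinguishing := by
  obtain ⟨hdk, hroom₁, hroom₂, hroom₃⟩ := le_choose_pred hd hn hnd hk hkd
  obtain ⟨K, hKG, hK⟩ := IsRegularOfDegree.exists_isTidy hG (by omega)
  obtain ⟨H, hHK, hH, hH'⟩ := hK.exists_noCycleComponent
  have hHG := hHK.trans hKG
  obtain ⟨R, hR⟩ : ∃ R : SimpleGraph V, ∀ v w, R.Adj v w ↔ G.Adj v w ∧ ¬H.Adj v w :=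
    ⟨G \ H, fun _ _ => sdiff_adj _ _ _ _⟩
  have hdeg : ∀ v, R.degree v + H.degree v = d := fun v => by
    rw [degree_add_degree_of_adj_iff hHG hR, hG]
  -- Vizing's theorem applies as R has degrees at most d - 1 < k - 1.
  obtain ⟨c₀, hc₀⟩ := R.exists_isProperOn_of_degree_lt_card (α := Fin (k - 1)) fun v => by
    have := hdeg v
    have := hH.degree_pos v
    rw [Fintype.card_fin]
    omega
  obtain ⟨c₁, hc₁⟩ := hc₀.exists_isBalanced
  have htwo : ∀ v, R.classSize c₁ (R.seen c₁ v) ≤ 2 := by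
    intro v
    refine hc₁.classSize_le_two ?_
    rw [hc₁.1.card_seen, Fintype.card_fin]
    have h₁ := hdeg v
    have h₂ := hH.degree_pos v
    have h₃ := hH.degree_le v
    have hle : #{w | R.degree w = R.degree v} ≤ Fintype.card V := card_le_univ _
    rcases (by omega : H.degree v = 1 ∨ H.degree v = 2 ∨ H.degree v = 3) with h | h | h
    · rw [show R.degree v = d - 1 by omega]
      have h₄ := hH.three_mul_card_leaves_le
      have h₅ : #{w | R.degree w = d - 1} ≤ #{w | H.degree w = 1} :=
        card_le_card fun w hw => by
          rw [mem_filter] at hw ⊢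
          have := hdeg w
          exact ⟨hw.1, by omega⟩
      omega
    · rw [show R.degree v = d - 2 by omega] at hle ⊢
      exact hle.trans hroom₂
    · rw [show R.degree v = d - 3 by omega] at hle ⊢
      exact hle.trans hroom₃
  obtain ⟨c₂, hc₂, hdist⟩ := hH.exists_distinguishing hH' (R.seen c₁)
    (fun u v h => by
      have h₁ := hc₁.1.card_seen u
      rw [h, hc₁.1.card_seen] at h₁
      have := hdeg u
      have := hdeg v
      omega)
    (fun u v w hv hw hvu hwu => by
      by_contra hvw
      have h := htwo u
      have h3 : #({u, v, w} : Finset V) = 3 :=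
        card_eq_three.2 ⟨u, v, w, hvu.symm, hwu.symm, hvw, rfl⟩
      have hsub : #({u, v, w} : Finset V) ≤ R.classSize c₁ (R.seen c₁ u) := by
        refine card_le_card fun x hx => ?_
        simp only [mem_insert, mem_singleton] at hx
        rw [mem_filter]
        rcases hx with rfl | rfl | rfl
        · exact ⟨mem_univ _, rfl⟩
        · exact ⟨mem_univ _, hv⟩
        · exact ⟨mem_univ _, hw⟩
      omega)
  obtain ⟨φ, hφ⟩ := exists_edgeKColoring_of_isProperOn (k := k + 3) (by omega) hR hc₁.1 hc₂ hHG
  exact ⟨φ, fun u v huv h => hdist u v huv (hφ u v h).1 (hφ u v h).2⟩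

end Assembly
end SimpleGraph

theorem theorem2 {V : Type*} [Fintype V] (G : SimpleGraph V) [DecidableRel G.Adj] (d : ℕ)
    (hG : G.IsRegularOfDegree d)
    (hd : Real.logb 2 (Fintype.card V) ≤ d)
    (hn : 8 ≤ Real.logb 2 (Fintype.card V)) :
    G.vdChromaticIndex ≤ (G.vdLowerBound : ℕ∞) + 3 := by
  have hd8 : 8 ≤ d := by exact_mod_cast hn.trans hd
  have hpos : (0 : ℝ) < Fintype.card V := by
    rw [Nat.cast_pos]
    by_contra h
    rw [Nat.le_zero.1 (not_lt.1 h)] at hn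
    norm_num at hn
  have hn256 : 256 ≤ Fintype.card V := by
    rw [Real.le_logb_iff_rpow_le (by norm_num) hpos] at hn
    norm_num at hn
    exact_mod_cast hn
  have hnd : Fintype.card V ≤ 2 ^ d := by
    rw [Real.logb_le_iff_le_rpow (by norm_num) hpos, Real.rpow_natCast] at hd
    exact_mod_cast hd
  obtain ⟨v⟩ : Nonempty V := Fintype.card_pos_iff.1 (by omega)
  have hmem : 3 * d / 2 ∈ {k : ℕ | ∀ i ∈ Set.Icc G.minDegree G.maxDegree,
      G.numDegree i ≤ k.choose i} := by
    intro i _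
    by_cases hi : i = d
    · rw [hi]
      exact (Finset.card_le_univ _).trans (hnd.trans (SimpleGraph.two_pow_le_choose d hd8))
    · rw [SimpleGraph.numDegree, Finset.card_eq_zero.2 (Finset.filter_eq_empty_iff.2 ?_)]
      · exact Nat.zero_le _
      · intro w _ hw
        exact hi (hw ▸ hG.degree_eq w)
  have hk : Fintype.card V ≤ G.vdLowerBound.choose d := by
    have h := Nat.sInf_mem ⟨_, hmem⟩ d
      ⟨(G.minDegree_le_degree v).trans_eq (hG.degree_eq v),
        (hG.degree_eq v).symm.trans_le (G.degree_le_maxDegree v)⟩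
    rwa [SimpleGraph.numDegree, Finset.filter_true_of_mem fun w _ => hG.degree_eq w,
      Finset.card_univ] at h
  obtain ⟨φ, hφ⟩ := SimpleGraph.exists_isVertexDistinguishing (G := G)
    (fun v => by convert hG.degree_eq v) hd8 hn256 hnd hk (Nat.sInf_le hmem)
  exact sInf_le ⟨G.vdLowerBound + 3, by push_cast; rfl, by omega, φ, hφ⟩
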